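/- Fix an integer $k\ge 0$ and a function $q:\mathbb{N}\to\mathbb{N}$ with $q(n)\ge 1$ for all $n$ and $q(n)=O(n^{c})$ for some constant $c$. Let $\Sigma_{q}=\{0,1,\dots,q-1\}$, and let an edit of a string over $\Sigma_q$ be the insertion or the deletion of a single symbol. Then there are functions $$\Phi=\Phi_n:\Sigma_{q(n)}^{n}\longrightarrow\{0,1,\dots,M(n)-1\},\qquad M(n)\le 2^{\,4k\log_2 n+4k\log_2 q(n)+O(\log\log n)}\quad(n\ge 1),$$ where the implied constant may depend on $k$ and on $q(\cdot)$, with the following properties. 1. $\Phi$ can correct $k$ edits: if $x\neq x'$ are strings in $\Sigma_{q(n)}^n$ and some $y\in\Sigma_{q(n)}^{*}$ can be obtained both from $x$ and from $x'$ by at most $k$ edits, then $\Phi(x)\neq\Phi(x')$. 2. There is a single algorithm that, given $n$, $q(n)$ and $x\in\Sigma_{q(n)}^n$, computes $\Phi(x)$ in time polynomial in $n$. 3. There is a single algorithm that, given $n$, $q(n)$, a string $y\in\Sigma_{q(n)}^*$ obtained from some $x\in\Sigma_{q(n)}^n$ by at most $k$ edits, and the value $\Phi(x)$, outputs $x$ in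 time polynomial in $n$. Algorithms are programs of a LISP-like language with while loops, which operates on binary trees; every instruction is charged at least the size of the data that it reads, so that polynomial time in this model is the usual polynomial time. Numbers and symbols are written in unary; all those that occur above are bounded by a polynomial in $n$. -/

import Mathlib

open Filter Asymptotics

namespace EditSyndrome

/-! ### Edits: insertions and deletions of single symbols -/

/-- `EditStep x y`: the string `y` is obtained from `x` by one edit, that is, by inserting one
symbol of the alphabet or by deleting one symbol. -/
inductive EditStep {α : Type} : List α → List α → Prop
  | insert (u v : List α) (a : α) : EditStep (u ++ v) (u ++ a :: v)
  | delete (u v : List α) (a : α) : EditStep (u ++ a :: v) (u ++ v)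

/-- `WithinEdits k x y`: the string `y` is obtained from `x` by at most `k` successive edits. -/
inductive WithinEdits {α : Type} : ℕ → List α → List α → Prop
  | refl (k : ℕ) (x : List α) : WithinEdits k x x
  | step {k : ℕ} {x y z : List α} :
      EditStep x y → WithinEdits k y z → WithinEdits (k + 1) x z

/-- A function `Φ` on the strings of length `n` over `α` can correct `k` edits: two distinct
strings of length `n` from which the same `y` can be obtained by at most `k` edits have distinct
values. -/
def CorrectsEdits {α β : Type} {n : ℕ} (k : ℕ) (Φ : List.Vector α n → β) : Prop :=
  ∀ (x x' : List.Vector α n) (y : List α),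
    WithinEdits k x.toList y → WithinEdits k x'.toList y → x ≠ x' → Φ x ≠ Φ x'

/-! ### The model of computation

Programs of a LISP-like language with `while` loops; the data are binary trees (S-expressions
whose only atom is `nil`). Every instruction is charged at least the size of the data that it reads,
so that no value is larger than the time spent on computing it, and running times agree with
those of Turing machines up to a polynomial. -/

/-- Binary trees. -/
inductive Data : Type
  | nil : Data
  | cons : Data → Data → Data

namespace Data

/-- The number of nodes and leaves of a tree. -/
def size : Data → ℕ
  | nil => 1
  | cons a b => a.size + b.size + 1

/-- The left subtree (`nil` for the empty tree). -/
def head : Data → Data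
  | nil => nil
  | cons a _ => a

/-- The right subtree (`nil` for the empty tree). -/
def tail : Data → Data
  | nil => nil
  | cons _ b => b

/-- A natural number, written in unary. -/
def ofNat : ℕ → Data
  | 0 => nil
  | m + 1 => cons nil (ofNat m)

/-- A string over the alphabet `{0, …, q - 1}`, written as the list of its symbols. -/
def ofString {q : ℕ} : List (Fin q) → Data
  | [] => nil
  | a :: x => cons (ofNat a) (ofString x)

end Data

/-- Programs. Each of them maps an input tree to an output tree:
`ident`, `nil`, `head`, `tail` are the basic instructions; `pair f g` conses the results of `f`
and `g`; `comp f g` runs `g` and then `f`; `cond c f g` runs `f` if `c` returns a tree other than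
`nil`, and `g` otherwise; `loop c f` applies `f` as long as `c` returns a tree other than `nil`. -/
inductive Program : Type
  | ident : Program
  | nil : Program
  | head : Program
  | tail : Program
  | pair : Program → Program → Program
  | comp : Program → Program → Program
  | cond : Program → Program → Program → Program
  | loop : Program → Program → Program

/-- `Runs P a b t`: on the input `a` the program `P` halts with the output `b` after `t` steps. -/
inductive Runs : Program → Data → Data → ℕ → Prop
  | ident (a : Data) : Runs .ident a a a.size
  | nil (a : Data) : Runs .nil a .nil a.size
  | head (a : Data) : Runs .head a a.head a.size
  | tail (a : Data) : Runs .tail a a.tail a.size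
  | pair {f g : Program} {a b c : Data} {s t : ℕ} :
      Runs f a b s → Runs g a c t → Runs (.pair f g) a (.cons b c) (a.size + s + t)
  | comp {f g : Program} {a b c : Data} {s t : ℕ} :
      Runs g a b s → Runs f b c t → Runs (.comp f g) a c (a.size + s + t)
  | cond_true {c f g : Program} {a b d e : Data} {s t : ℕ} :
      Runs c a (.cons d e) s → Runs f a b t → Runs (.cond c f g) a b (a.size + s + t)
  | cond_false {c f g : Program} {a b : Data} {s t : ℕ} :
      Runs c a .nil s → Runs g a b t → Runs (.cond c f g) a b (a.size + s + t)
  | loop_done {c f : Program} {a : Data} {s : ℕ} :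
      Runs c a .nil s → Runs (.loop c f) a a (a.size + s)
  | loop_step {c f : Program} {a b d e z : Data} {s t u : ℕ} :
      Runs c a (.cons d e) s → Runs f a b t → Runs (.loop c f) b z u →
        Runs (.loop c f) a z (a.size + s + t + u)

/-- On the input `a` the program `P` halts with the output `b` after at most `T` steps. -/
def RunsWithin (P : Program) (a b : Data) (T : ℕ) : Prop :=
  ∃ t : ℕ, t ≤ T ∧ Runs P a b t

/-- The input of the program that computes the syndrome: the parameters `n` and `q`, and `x`. -/
def syndromeInput (n q : ℕ) (x : List (Fin q)) : Data :=
  .cons (.ofNat n) (.cons (.ofNat q) (.ofString x))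

/-- The input of the recovery program: the parameters `n` and `q`, the received string `y`, and
the value `s` of the syndrome. -/
def recoveryInput (n q : ℕ) (y : List (Fin q)) (s : ℕ) : Data :=
  .cons (.ofNat n) (.cons (.ofNat q) (.cons (.ofString y) (.ofNat s)))

end EditSyndrome

/-! Join two distinct strings of length `n` when they are within `2 * k` edits of each other. Since
edits are reversible, two strings with a common `y` within `k` edits are joined, so a proper
colouring of this graph corrects `k` edits. Conversely `x` is found again by listing the strings
within `k` edits of `y` and keeping the one of the right length and colour. Every closed
neighbourhood has at most `N = ballBound k n q` members, about `(n * q) ^ (2 * k)`. What is needed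
is a proper colouring with `O(N ^ 2)` colours in which the colour of `x` is computed from a small
part of the graph.

This is Linial's colour reduction. Read words of length `L` over `{0, …, p - 1}` as polynomials of
degree less than `L` over the field with `p` elements. Two distinct ones agree at no more than `L`
points, so if `p > N * L`, some point `a` separates the polynomial of `x` from those of all its
neighbours (`pick_spec`). The pair of `a` and the value at `a` is a proper colour (`colour_ne`):
equal pairs would mean equal points and equal values there.

The first round has `L = n` and a prime of size about `N * n`, at most `N ^ 2`; its colour is a word
of four digits in base `N`. The second round has `L = 4` and a prime `p ≤ 8 * N`, so that `p ^ 2 ≤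
64 * N ^ 2` colours remain, and only a constant is lost in the exponent.

For fixed `k` everything is a search through lists of polynomial length. The running times follow
from closure properties of `PolyTime`, where `PolyTime.foldl` carries all the loops. -/

namespace EditSyndrome

/-! ### Functions computable in polynomial time -/

/-- A type whose elements are written as trees. -/
class Enc (α : Type) where
  enc : α → Data

open Enc

/-- The list of the trees of the entries. -/
def encList {α : Type} [Enc α] : List α → Data
  | [] => .nil
  | a :: l => .cons (enc a) (encList l)

instance : Enc ℕ := ⟨Data.ofNat⟩
instance : Enc Unit := ⟨fun _ => .nil⟩
instance : Enc Bool := ⟨fun b => if b then .cons .nil .nil else .nil⟩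
instance {α β : Type} [Enc α] [Enc β] : Enc (α × β) := ⟨fun p => .cons (enc p.1) (enc p.2)⟩
instance {α : Type} [Enc α] : Enc (List α) := ⟨encList⟩

/-- The size of the tree of `a`. -/
def sz {α : Type} [Enc α] (a : α) : ℕ := (enc a).size

/-! ### Sizes of encoded data. -/

section size

variable {α β : Type} [Enc α] [Enc β]

theorem Data.size_pos (a : Data) : 1 ≤ a.size := by
  cases a <;> simp [Data.size]

theorem sz_pos (a : α) : 1 ≤ sz a := Data.size_pos _

theorem sz_prod (a : α) (b : β) : sz (a, b) = sz a + sz b + 1 := rfl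

theorem sz_nil : sz ([] : List α) = 1 := rfl

theorem sz_cons (a : α) (l : List α) : sz (a :: l) = sz a + sz l + 1 := rfl

theorem sz_nat (m : ℕ) : sz m = 2 * m + 1 := by
  induction m with
  | zero => rfl
  | succ m ih =>
    have : sz (m + 1) = 1 + sz m + 1 := rfl
    omega

theorem sz_append (l m : List α) : sz (l ++ m) + 1 = sz l + sz m := by
  induction l with
  | nil => simp [sz_nil]; omega
  | cons a l ih => simp only [List.cons_append, sz_cons]; omega

theorem sz_reverse (l : List α) : sz l.reverse = sz l := by
  induction l with
  | nil => rfl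
  | cons a l ih =>
    have := sz_append l.reverse [a]
    simp only [List.reverse_cons, sz_cons, sz_nil] at *
    omega

theorem length_lt_sz (l : List α) : l.length < sz l := by
  induction l with
  | nil => simp [sz_nil]
  | cons a l ih => simp only [List.length_cons, sz_cons]; omega

theorem sz_mem {a : α} {l : List α} (h : a ∈ l) : sz a < sz l := by
  induction l with
  | nil => simp at h
  | cons b l ih =>
    rw [sz_cons]
    rcases List.mem_cons.1 h with rfl | h
    · have := sz_pos l; omega
    · have := ih h; omega

theorem sz_prefix {l m : List α} (h : l <+: m) : sz l ≤ sz m := by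
  obtain ⟨r, rfl⟩ := h
  have := sz_append l r
  have := sz_pos r
  omega

theorem sz_list_le {l : List α} {B : ℕ} (h : ∀ a ∈ l, sz a ≤ B) :
    sz l ≤ l.length * (B + 1) + 1 := by
  induction l with
  | nil => simp [sz_nil]
  | cons a l ih =>
    have h1 := h a (by simp)
    have h2 := ih fun b hb => h b (by simp [hb])
    rw [sz_cons, List.length_cons, add_mul]
    omega

theorem enc_replicate_unit (m : ℕ) : enc (List.replicate m ()) = enc m := by
  induction m with
  | zero => rfl
  | succ m ih => exact congrArg (Data.cons .nil) ih

end size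

theorem eval_mono (T : Polynomial ℕ) {m n : ℕ} (h : m ≤ n) : T.eval m ≤ T.eval n := by
  rw [Polynomial.eval_eq_sum_range, Polynomial.eval_eq_sum_range]
  gcongr

/-! #### Running times -/

/-- Each instruction is charged for its data, so a time bound is also a bound on the output. This is
what makes polynomial time closed under composition. -/
theorem Runs.size_le {P : Program} {a b : Data} {t : ℕ} (h : Runs P a b t) : b.size ≤ t := by
  induction h with
  | ident a => exact le_rfl
  | nil a => exact Data.size_pos a
  | head a => cases a <;> simp [Data.head, Data.size]; omega
  | tail a => cases a <;> simp [Data.tail, Data.size]; omega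
  | @pair f g a b c s t _ _ _ _ =>
    have := Data.size_pos a
    simp only [Data.size]; omega
  | _ => omega

theorem RunsWithin.size_le {P : Program} {a b : Data} {t : ℕ} (h : RunsWithin P a b t) :
    b.size ≤ t := by
  obtain ⟨s, hs, h⟩ := h
  exact h.size_le.trans hs

theorem RunsWithin.mono {P : Program} {a b : Data} {s t : ℕ} (h : RunsWithin P a b s)
    (hst : s ≤ t) : RunsWithin P a b t := by
  obtain ⟨u, hu, h⟩ := h
  exact ⟨u, hu.trans hst, h⟩

theorem RunsWithin.comp {f g : Program} {a b c : Data} {s t : ℕ} (hg : RunsWithin g a b s)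
    (hf : RunsWithin f b c t) : RunsWithin (.comp f g) a c (a.size + s + t) := by
  obtain ⟨s', hs, h⟩ := hg
  obtain ⟨t', ht, h'⟩ := hf
  exact ⟨_, by omega, .comp h h'⟩

theorem RunsWithin.pair {f g : Program} {a b c : Data} {s t : ℕ} (hf : RunsWithin f a b s)
    (hg : RunsWithin g a c t) : RunsWithin (.pair f g) a (.cons b c) (a.size + s + t) := by
  obtain ⟨s', hs, h⟩ := hf
  obtain ⟨t', ht, h'⟩ := hg
  exact ⟨_, by omega, .pair h h'⟩

/-- A function that some program computes in time polynomial in the size of the argument. -/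
def PolyTime {α β : Type} [Enc α] [Enc β] (f : α → β) : Prop :=
  ∃ (P : Program) (T : Polynomial ℕ), ∀ a, RunsWithin P (enc a) (enc (f a)) (T.eval (sz a))

/-- A numerical function bounded by a polynomial in the size of the argument. -/
def PolyBound {α : Type} [Enc α] (b : α → ℕ) : Prop :=
  ∃ T : Polynomial ℕ, ∀ a, b a ≤ T.eval (sz a)

/-! ### Closure properties of polynomial time. -/

section closure

variable {α β γ δ : Type} [Enc α] [Enc β] [Enc γ] [Enc δ]

theorem PolyBound.const (m : ℕ) : PolyBound (fun _ : α => m) :=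
  ⟨.C m, fun _ => by simp⟩

theorem PolyBound.size : PolyBound (fun a : α => sz a) :=
  ⟨.X, fun _ => by simp⟩

theorem PolyBound.add {b c : α → ℕ} (hb : PolyBound b) (hc : PolyBound c) :
    PolyBound (fun a => b a + c a) := by
  obtain ⟨S, hS⟩ := hb
  obtain ⟨T, hT⟩ := hc
  exact ⟨S + T, fun a => by rw [Polynomial.eval_add]; exact add_le_add (hS a) (hT a)⟩

theorem PolyBound.mul {b c : α → ℕ} (hb : PolyBound b) (hc : PolyBound c) :
    PolyBound (fun a => b a * c a) := by
  obtain ⟨S, hS⟩ := hb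
  obtain ⟨T, hT⟩ := hc
  exact ⟨S * T, fun a => by rw [Polynomial.eval_mul]; exact Nat.mul_le_mul (hS a) (hT a)⟩

theorem PolyBound.eval {b : α → ℕ} (hb : PolyBound b) (T : Polynomial ℕ) :
    PolyBound (fun a => T.eval (b a)) := by
  obtain ⟨S, hS⟩ := hb
  exact ⟨T.comp S, fun a => by rw [Polynomial.eval_comp]; exact eval_mono T (hS a)⟩

theorem PolyTime.polyBound {f : α → β} (hf : PolyTime f) : PolyBound (fun a => sz (f a)) := by
  obtain ⟨P, T, h⟩ := hf
  exact ⟨T, fun a => (h a).size_le⟩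

theorem PolyTime.of_runs {f : α → β} (P : Program)
    (h : ∀ a, Runs P (enc a) (enc (f a)) (sz a)) : PolyTime f :=
  ⟨P, .X, fun a => ⟨_, by simp, h a⟩⟩

/-- Programs see only trees, so values of different types with the same tree are interchangeable: a
nonempty list and the pair of its head and tail, or a number and a list of units. -/
theorem PolyTime.of_enc_eq {f : α → β} {g : α → γ} (hf : PolyTime f)
    (h : ∀ a, enc (f a) = enc (g a)) : PolyTime g := by
  obtain ⟨P, T, hP⟩ := hf
  exact ⟨P, T, fun a => h a ▸ hP a⟩

theorem PolyTime.congr {f g : α → β} (hf : PolyTime f) (h : ∀ a, f a = g a) : PolyTime g :=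
  funext h ▸ hf

theorem PolyTime.id : PolyTime (fun a : α => a) := .of_runs .ident fun _ => .ident _

theorem PolyTime.fst : PolyTime (fun p : α × β => p.1) := .of_runs .head fun _ => .head _

theorem PolyTime.snd : PolyTime (fun p : α × β => p.2) := .of_runs .tail fun _ => .tail _

theorem PolyTime.comp {f : β → γ} {g : α → β} (hf : PolyTime f) (hg : PolyTime g) :
    PolyTime (fun a => f (g a)) := by
  obtain ⟨P, S, hP⟩ := hf
  obtain ⟨Q, T, hQ⟩ := hg
  refine ⟨.comp P Q, .X + T + S.comp T, fun a => ((hQ a).comp (hP (g a))).mono ?_⟩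
  have h := eval_mono S (hQ a).size_le
  simp only [Polynomial.eval_add, Polynomial.eval_X, Polynomial.eval_comp]
  unfold sz at *
  omega

theorem PolyTime.prodMk {f : α → β} {g : α → γ} (hf : PolyTime f) (hg : PolyTime g) :
    PolyTime (fun a => (f a, g a)) := by
  obtain ⟨P, S, hP⟩ := hf
  obtain ⟨Q, T, hQ⟩ := hg
  exact ⟨.pair P Q, .X + S + T, fun a => ((hP a).pair (hQ a)).mono (by simp [sz])⟩

theorem PolyTime.cons {f : α → β} {g : α → List β} (hf : PolyTime f) (hg : PolyTime g) :
    PolyTime (fun a => f a :: g a) :=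
  (hf.prodMk hg).of_enc_eq fun _ => rfl

theorem exists_const_program (d : Data) :
    ∃ (P : Program) (T : Polynomial ℕ), ∀ a, RunsWithin P a d (T.eval a.size) := by
  induction d with
  | nil => exact ⟨.nil, .X, fun a => ⟨_, by simp, .nil a⟩⟩
  | cons d e ihd ihe =>
    obtain ⟨P, S, hP⟩ := ihd
    obtain ⟨Q, T, hQ⟩ := ihe
    exact ⟨.pair P Q, .X + S + T, fun a => ((hP a).pair (hQ a)).mono (by simp)⟩

theorem PolyTime.const (b : β) : PolyTime (fun _ : α => b) := by
  obtain ⟨P, T, h⟩ := exists_const_program (enc b)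
  exact ⟨P, T, fun a => h _⟩

theorem PolyTime.ite_ne_nil {c : α → γ} {f g : α → β} (hc : PolyTime c) (hf : PolyTime f)
    (hg : PolyTime g) {p : α → Prop} [DecidablePred p] (h : ∀ a, p a ↔ enc (c a) ≠ .nil) :
    PolyTime (fun a => if p a then f a else g a) := by
  obtain ⟨R, U, hR⟩ := hc
  obtain ⟨P, S, hP⟩ := hf
  obtain ⟨Q, T, hQ⟩ := hg
  refine ⟨.cond R P Q, .X + U + S + T, fun a => ?_⟩
  obtain ⟨u, hu, h1⟩ := hR a
  obtain ⟨s, hs, h2⟩ := hP a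
  obtain ⟨t, ht, h3⟩ := hQ a
  simp only [Polynomial.eval_add, Polynomial.eval_X]
  rcases he : enc (c a) with _ | ⟨d, e⟩
  · have : ¬ p a := by rw [h, he]; simp
    simp only [this, if_false]
    exact ⟨(enc a).size + u + t, by unfold sz at *; omega, .cond_false (he ▸ h1) h3⟩
  · have : p a := by rw [h, he]; simp
    simp only [this, if_true]
    exact ⟨(enc a).size + u + s, by unfold sz at *; omega, .cond_true (he ▸ h1) h2⟩

theorem PolyTime.ite {c : α → Bool} {f g : α → β} (hc : PolyTime c) (hf : PolyTime f)
    (hg : PolyTime g) : PolyTime (fun a => if c a then f a else g a) :=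
  hc.ite_ne_nil hf hg fun a => by cases c a <;> simp [enc]

theorem PolyTime.and {c d : α → Bool} (hc : PolyTime c) (hd : PolyTime d) :
    PolyTime (fun a => c a && d a) :=
  (hc.ite hd (.const false)).congr fun a => by cases c a <;> simp

theorem PolyTime.or {c d : α → Bool} (hc : PolyTime c) (hd : PolyTime d) :
    PolyTime (fun a => c a || d a) :=
  (hc.ite (.const true) hd).congr fun a => by cases c a <;> simp

theorem PolyTime.not {c : α → Bool} (hc : PolyTime c) : PolyTime (fun a => !c a) :=
  (hc.ite (.const false) (.const true)).congr fun a => by cases c a <;> simp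

theorem PolyTime.succ {f : α → ℕ} (hf : PolyTime f) : PolyTime (fun a => f a + 1) :=
  ((PolyTime.const ()).prodMk hf).of_enc_eq fun _ => rfl

theorem PolyTime.pred {f : α → ℕ} (hf : PolyTime f) : PolyTime (fun a => (f a).pred) := by
  refine PolyTime.comp (f := Nat.pred) (.of_runs .tail fun m => ?_) hf
  cases m <;> exact .tail _

theorem PolyTime.eq_zero {f : α → ℕ} (hf : PolyTime f) :
    PolyTime (fun a => decide (f a = 0)) := by
  refine (hf.ite_ne_nil (.const false) (.const true) (p := fun a => f a ≠ 0) fun a => ?_).congr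
    fun a => by by_cases h : f a = 0 <;> simp [h]
  cases f a <;> simp [enc, Data.ofNat]

theorem PolyTime.tail {f : α → List β} (hf : PolyTime f) : PolyTime (fun a => (f a).tail) := by
  refine PolyTime.comp (f := List.tail) (.of_runs .tail fun m => ?_) hf
  cases m <;> exact .tail _

theorem PolyTime.headD {f : α → List β} (hf : PolyTime f) (d : β) (hd : enc d = .nil) :
    PolyTime (fun a => (f a).headD d) := by
  refine PolyTime.comp (f := fun l : List β => l.headD d) (.of_runs .head fun m => ?_) hf
  cases m
  · simp only [List.headD_nil, hd]; exact .head _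
  · exact .head _

theorem PolyTime.isEmpty {f : α → List β} (hf : PolyTime f) :
    PolyTime (fun a => (f a).isEmpty) := by
  refine (hf.ite_ne_nil (.const false) (.const true)
    (p := fun a => (f a).isEmpty = false) fun a => ?_).congr
    fun a => by cases (f a).isEmpty <;> simp
  cases f a <;> simp [enc, encList]

/-! #### Loops -/

/-- The loop state holds the remaining list, the accumulator and a fixed context; its head is `nil`
exactly when the list is exhausted. The bound `B` has to cover the accumulator after every prefix,
since a polynomial step iterated freely may grow exponentially. -/
theorem loop_foldl {P : Program} {T : Polynomial ℕ} {s : α → β → α} {c : γ}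
    (hP : ∀ (b : β) (l : List β) (a : α), RunsWithin P (enc (b :: l, a, c)) (enc (l, s a b, c))
      (T.eval (sz (b :: l, a, c)))) (B : ℕ) (l : List β) (a : α)
    (hB : ∀ m, m <+: l → sz (m.foldl s a) ≤ B) :
    RunsWithin (.loop .head P) (enc (l, a, c)) (enc (([] : List β), l.foldl s a, c))
      ((l.length + 1) * (2 * (sz l + B + sz c + 2) + T.eval (sz l + B + sz c + 2))) := by
  induction l generalizing a with
  | nil =>
    have h := hB [] List.prefix_rfl
    simp only [List.foldl_nil] at h
    have hd := Runs.loop_done (f := P) (Runs.head (enc (([] : List β), a, c)))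
    refine ⟨_, ?_, hd⟩
    change sz (([] : List β), a, c) + sz (([] : List β), a, c) ≤ _
    simp only [sz_prod, List.length_nil]
    omega
  | cons b l ih =>
    obtain ⟨u, hu, h1⟩ := ih (s a b) fun m hm => hB (b :: m) (by simpa using hm)
    obtain ⟨t, ht, h2⟩ := hP b l a
    have h := hB [] (List.nil_prefix)
    simp only [List.foldl_nil] at h
    have hd := Runs.loop_step (Runs.head (enc (b :: l, a, c))) h2 h1
    refine ⟨_, ?_, hd⟩
    change sz (b :: l, a, c) + sz (b :: l, a, c) + t + u ≤ _
    have hz : sz (b :: l, a, c) ≤ sz (b :: l) + B + sz c + 2 := by simp only [sz_prod]; omega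
    have hle : sz l ≤ sz (b :: l) := by rw [sz_cons]; omega
    have h4 := ht.trans (eval_mono T hz)
    have h5 : u ≤ (l.length + 1) * (2 * (sz (b :: l) + B + sz c + 2) +
        T.eval (sz (b :: l) + B + sz c + 2)) :=
      hu.trans (Nat.mul_le_mul_left _ (add_le_add (by omega) (eval_mono T (by omega))))
    rw [List.length_cons, add_mul (l.length + 1) 1, one_mul]
    omega

theorem PolyTime.foldl {s : γ → α → β → α} {g : γ → List β} {i : γ → α}
    (hs : PolyTime (fun p : γ × α × β => s p.1 p.2.1 p.2.2)) (hg : PolyTime g) (hi : PolyTime i)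
    {b : γ → ℕ} (hb : PolyBound b)
    (h : ∀ c l, l <+: g c → sz (l.foldl (s c) (i c)) ≤ b c) :
    PolyTime (fun c => (g c).foldl (s c) (i c)) := by
  -- The nonempty list `b :: l` is taken as the pair `(b, l)`, which has the same tree, so that
  -- projections suffice.
  have hbody : PolyTime (fun z : (β × List β) × α × γ => (z.1.2, s z.2.2 z.2.1 z.1.1, z.2.2)) := by
    have h1 := PolyTime.fst (α := β × List β) (β := α × γ)
    have h2 := PolyTime.snd (α := β × List β) (β := α × γ)
    exact (PolyTime.snd.comp h1).prodMk ((hs.comp ((PolyTime.snd.comp h2).prodMk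
      ((PolyTime.fst.comp h2).prodMk (PolyTime.fst.comp h1)))).prodMk (PolyTime.snd.comp h2))
  obtain ⟨P, T, hP⟩ := hbody
  have hstart := hg.prodMk (hi.prodMk (PolyTime.id (α := γ)))
  obtain ⟨Q, S, hQ⟩ := hstart
  have hlen : PolyBound (fun c => ((g c).length + 1) * (2 * (sz (g c) + b c + sz c + 2) +
      T.eval (sz (g c) + b c + sz c + 2))) := by
    have hz := ((hg.polyBound.add hb).add .size).add (.const 2)
    have hl : PolyBound (fun c => (g c).length + 1) := by
      obtain ⟨U, hU⟩ := hg.polyBound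
      exact ⟨U, fun c => (length_lt_sz (g c)).trans_le (hU c)⟩
    exact hl.mul (((PolyBound.const 2).mul hz).add (hz.eval T))
  obtain ⟨U, hU⟩ := hlen
  have hloop : PolyTime (fun c => (([] : List β), (g c).foldl (s c) (i c), c)) := by
    refine ⟨.comp (.loop .head P) Q, .X + S + U, fun c => ?_⟩
    have h1 := loop_foldl (s := s c) (c := c) (fun b' l a => hP ((b', l), a, c)) (b c) (g c) (i c)
      (h c)
    refine ((hQ c).comp h1).mono ?_
    have := hU c
    beta_reduce at this
    simp only [Polynomial.eval_add, Polynomial.eval_X]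
    unfold sz at *
    omega
  exact PolyTime.fst.comp (PolyTime.snd.comp hloop)

theorem PolyTime.iterate {s : γ → α → α} {m : γ → ℕ} {i : γ → α}
    (hs : PolyTime (fun p : γ × α => s p.1 p.2)) (hm : PolyTime m) (hi : PolyTime i)
    {b : γ → ℕ} (hb : PolyBound b) (h : ∀ c j, j ≤ m c → sz ((s c)^[j] (i c)) ≤ b c) :
    PolyTime (fun c => (s c)^[m c] (i c)) := by
  have key : ∀ (c : γ) (a : α) (l : List Unit),
      l.foldl (fun a _ => s c a) a = (s c)^[l.length] a := by
    intro c a l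
    induction l generalizing a with
    | nil => rfl
    | cons _ l ih => simp [ih]
  have hg : PolyTime (fun c => List.replicate (m c) ()) :=
    hm.of_enc_eq fun c => (enc_replicate_unit _).symm
  have hs' : PolyTime (fun p : γ × α × Unit => s p.1 p.2.1) :=
    hs.comp (PolyTime.fst.prodMk (PolyTime.fst.comp PolyTime.snd))
  refine (PolyTime.foldl (s := fun c a _ => s c a) hs' hg hi hb fun c l hl => ?_).congr
    fun c => by rw [key, List.length_replicate]
  rw [key]
  exact h c _ (by simpa using hl.length_le)

end closure

/-! #### Functions on numbers and lists -/

theorem foldl_flip_cons {δ : Type*} (l m : List δ) :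
    l.foldl (fun r b => b :: r) m = l.reverse ++ m := by
  induction l generalizing m with
  | nil => rfl
  | cons b l ih => simp [ih]

section functions

variable {α β γ : Type} [Enc α] [Enc β] [Enc γ]

/-! #### Arithmetic in unary -/

theorem PolyTime.add {f g : α → ℕ} (hf : PolyTime f) (hg : PolyTime g) :
    PolyTime (fun a => f a + g a) := by
  refine (PolyTime.iterate (s := fun _ r => r + 1) (PolyTime.succ .snd) hg hf
    (hf.polyBound.add ((PolyBound.const 2).mul hg.polyBound)) fun c j hj => ?_).congr fun c => ?_
  · rw [show (fun r => r + 1) = Nat.succ from rfl, Nat.succ_iterate, sz_nat, sz_nat, sz_nat]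
    omega
  · exact Nat.succ_iterate _ _

theorem PolyTime.sub {f g : α → ℕ} (hf : PolyTime f) (hg : PolyTime g) :
    PolyTime (fun a => f a - g a) := by
  refine (PolyTime.iterate (s := fun _ r => r.pred) (PolyTime.pred .snd) hg hf
    hf.polyBound fun c j hj => ?_).congr fun c => ?_
  · rw [Nat.pred_iterate, sz_nat, sz_nat]
    omega
  · exact Nat.pred_iterate _ _

theorem PolyTime.mul {f g : α → ℕ} (hf : PolyTime f) (hg : PolyTime g) :
    PolyTime (fun a => f a * g a) := by
  have key : ∀ a j : ℕ, (fun r => r + a)^[j] 0 = a * j := fun a j => by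
    induction j with
    | zero => rfl
    | succ j ih => rw [Function.iterate_succ_apply', ih, mul_add, mul_one]
  refine (PolyTime.iterate (s := fun c r => r + f c)
    (PolyTime.add .snd (hf.comp .fst)) hg (.const 0)
    (hf.polyBound.mul hg.polyBound) fun c j hj => ?_).congr fun c => key _ _
  rw [key, sz_nat, sz_nat, sz_nat]
  have := Nat.mul_le_mul_left (f c) hj
  nlinarith

theorem PolyTime.pow {f : α → ℕ} (hf : PolyTime f) (m : ℕ) : PolyTime (fun a => f a ^ m) := by
  induction m with
  | zero => exact .const 1
  | succ m ih => exact ih.mul hf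

theorem PolyTime.le {f g : α → ℕ} (hf : PolyTime f) (hg : PolyTime g) :
    PolyTime (fun a => decide (f a ≤ g a)) :=
  (hf.sub hg).eq_zero.congr fun a => by simp only [Nat.sub_eq_zero_iff_le]

theorem PolyTime.lt {f g : α → ℕ} (hf : PolyTime f) (hg : PolyTime g) :
    PolyTime (fun a => decide (f a < g a)) :=
  hf.succ.le hg

theorem PolyTime.eq {f g : α → ℕ} (hf : PolyTime f) (hg : PolyTime g) :
    PolyTime (fun a => decide (f a = g a)) :=
  ((hf.le hg).and (hg.le hf)).congr fun a => by
    rw [← Bool.decide_and, decide_eq_decide]; omega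

/-- One step of counting up, with quotient and remainder modulo `b`. -/
def divModStep (b : ℕ) (p : ℕ × ℕ) : ℕ × ℕ :=
  if p.2 + 1 = b then (p.1 + 1, 0) else (p.1, p.2 + 1)

theorem divModStep_iterate (a b : ℕ) : (divModStep b)^[a] (0, 0) = (a / b, a % b) := by
  induction a with
  | zero => simp
  | succ a ih =>
    rw [Function.iterate_succ_apply', ih, divModStep]
    rcases Nat.eq_zero_or_pos b with rfl | hb
    -- For `b = 0` the remainder is never reset, which agrees with the conventions `a / 0 = 0` and
    -- `a % 0 = a`.
    · simp
    have h1 := Nat.div_add_mod a b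
    have h2 := Nat.mod_lt a hb
    split_ifs with h <;> simp only at h ⊢
    · have h3 := (Nat.div_mod_unique (d := a / b + 1) (c := 0) (a := a + 1) hb).2
        ⟨by rw [mul_add]; omega, hb⟩
      rw [h3.1, h3.2]
    · have h3 := (Nat.div_mod_unique (d := a / b) (c := a % b + 1) (a := a + 1) hb).2
        ⟨by omega, by omega⟩
      rw [h3.1, h3.2]

theorem PolyTime.divMod {f g : α → ℕ} (hf : PolyTime f) (hg : PolyTime g) :
    PolyTime (fun a => (f a / g a, f a % g a)) := by
  have hs : PolyTime (fun p : α × ℕ × ℕ => divModStep (g p.1) p.2) := by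
    have h1 : PolyTime (fun p : α × ℕ × ℕ => p.2.1) := PolyTime.fst.comp .snd
    have h2 : PolyTime (fun p : α × ℕ × ℕ => p.2.2 + 1) := .succ (PolyTime.snd.comp .snd)
    refine ((h2.eq (hg.comp .fst)).ite (h1.succ.prodMk (.const 0)) (h1.prodMk h2)).congr ?_
    intro p
    simp only [divModStep, decide_eq_true_eq]
  refine (PolyTime.iterate hs hf (.const (0, 0))
    (((PolyBound.const 2).mul hf.polyBound).add (.const 1)) fun c j hj => ?_).congr
    fun c => divModStep_iterate _ _
  rw [divModStep_iterate, sz_prod, sz_nat, sz_nat, sz_nat]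
  have := Nat.div_le_self j (g c)
  have := Nat.mod_le j (g c)
  omega

theorem PolyTime.div {f g : α → ℕ} (hf : PolyTime f) (hg : PolyTime g) :
    PolyTime (fun a => f a / g a) :=
  PolyTime.fst.comp (hf.divMod hg)

theorem PolyTime.mod {f g : α → ℕ} (hf : PolyTime f) (hg : PolyTime g) :
    PolyTime (fun a => f a % g a) :=
  PolyTime.snd.comp (hf.divMod hg)

/-! #### Lists -/

theorem PolyTime.reverseAppend {f g : α → List β} (hf : PolyTime f) (hg : PolyTime g) :
    PolyTime (fun a => (f a).reverse ++ g a) := by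
  refine (PolyTime.foldl (s := fun _ r b => b :: r) ?_ hf hg (hf.polyBound.add hg.polyBound)
    fun c l hl => ?_).congr fun c => foldl_flip_cons _ _
  · exact (PolyTime.snd.comp .snd).cons (PolyTime.fst.comp .snd)
  · rw [foldl_flip_cons]
    have h1 := sz_append l.reverse (g c)
    have h2 := sz_prefix hl
    rw [sz_reverse] at h1
    omega

theorem PolyTime.reverse {f : α → List β} (hf : PolyTime f) :
    PolyTime (fun a => (f a).reverse) :=
  (hf.reverseAppend (.const [])).congr fun a => by simp

theorem PolyTime.append {f g : α → List β} (hf : PolyTime f) (hg : PolyTime g) :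
    PolyTime (fun a => f a ++ g a) :=
  (hf.reverse.reverseAppend hg).congr fun a => by simp

theorem PolyTime.length {f : α → List β} (hf : PolyTime f) :
    PolyTime (fun a => (f a).length) := by
  have key : ∀ (l : List β) (m : ℕ), l.foldl (fun r _ => r + 1) m = m + l.length := by
    intro l
    induction l with
    | nil => simp
    | cons b l ih => intro m; simp only [List.foldl_cons, List.length_cons, ih]; omega
  refine (PolyTime.foldl (s := fun _ r _ => r + 1) (.succ (PolyTime.fst.comp .snd)) hf (.const 0)
    ((PolyBound.const 2).mul hf.polyBound) fun c l hl => ?_).congr fun c => ?_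
  · rw [key, sz_nat]
    have h1 := length_lt_sz (f c)
    have h2 := hl.length_le
    omega
  · rw [key, zero_add]

theorem PolyTime.drop {f : α → ℕ} {g : α → List β} (hf : PolyTime f) (hg : PolyTime g) :
    PolyTime (fun a => (g a).drop (f a)) := by
  have key : ∀ (j : ℕ) (l : List β), List.tail^[j] l = l.drop j := by
    intro j
    induction j with
    | zero => simp
    | succ j ih => intro l; rw [Function.iterate_succ_apply, ih, List.drop_tail]
  refine (PolyTime.iterate (s := fun _ l => l.tail) (.tail .snd) hf hg hg.polyBound
    fun c j hj => ?_).congr fun c => key _ _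
  rw [key]
  have h1 := sz_append ((g c).take j) ((g c).drop j)
  have h2 := sz_pos ((g c).take j)
  rw [List.take_append_drop] at h1
  omega

theorem PolyTime.take {f : α → ℕ} {g : α → List β} (hf : PolyTime f) (hg : PolyTime g) :
    PolyTime (fun a => (g a).take (f a)) :=
  (((hg.length.sub hf).drop hg.reverse).reverse).congr fun a => by
    rw [List.drop_reverse, List.reverse_reverse]
    rcases le_total (f a) (g a).length with h | h
    · rw [Nat.sub_sub_self h]
    · rw [Nat.sub_eq_zero_of_le h, Nat.sub_zero, List.take_length, List.take_of_length_le h]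

theorem PolyTime.map {s : α → β → γ} {f : α → List β}
    (hs : PolyTime (fun p : α × β => s p.1 p.2)) (hf : PolyTime f) :
    PolyTime (fun a => (f a).map (s a)) := by
  have key : ∀ (a : α) (l : List β) (m : List γ),
      l.foldl (fun r b => s a b :: r) m = (l.map (s a)).reverse ++ m := by
    intro a l
    induction l with
    | nil => simp
    | cons b l ih => intro m; simp [ih]
  obtain ⟨T, hT⟩ := hs.polyBound
  -- An entry of `f a` is smaller than the whole list, so `T` at `sz a + sz (f a) + 1` bounds every
  -- image, and there are fewer than `sz (f a)` of them.
  have hb : PolyBound (fun a => sz (f a) * (T.eval (sz a + sz (f a) + 1) + 1) + 1) :=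
    (hf.polyBound.mul ((((PolyBound.size.add hf.polyBound).add (.const 1)).eval T).add
      (.const 1))).add (.const 1)
  have h1 : PolyTime (fun a => (f a).foldl (fun r b => s a b :: r) []) := by
    refine PolyTime.foldl (s := fun a r b => s a b :: r) ?_ hf (.const []) hb fun a l hl => ?_
    · exact (hs.comp (PolyTime.fst.prodMk (PolyTime.snd.comp .snd))).cons (PolyTime.fst.comp .snd)
    · rw [key, List.append_nil, sz_reverse]
      have h2 : ∀ c ∈ l.map (s a), sz c ≤ T.eval (sz a + sz (f a) + 1) := by
        intro c hc
        obtain ⟨b, hb, rfl⟩ := List.mem_map.1 hc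
        refine (hT (a, b)).trans (eval_mono T ?_)
        have := sz_mem (hl.subset hb)
        rw [sz_prod]
        omega
      refine (sz_list_le h2).trans (Nat.add_le_add_right (Nat.mul_le_mul_right _ ?_) 1)
      rw [List.length_map]
      exact hl.length_le.trans (length_lt_sz _).le
  exact h1.reverse.congr fun a => by rw [key]; simp

theorem sz_flatten_le (l : List (List β)) : sz l.flatten ≤ sz l := by
  induction l with
  | nil => rfl
  | cons b l ih =>
    have := sz_append b l.flatten
    rw [List.flatten_cons, sz_cons]
    omega

theorem PolyTime.flatten {f : α → List (List β)} (hf : PolyTime f) :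
    PolyTime (fun a => (f a).flatten) := by
  have key : ∀ (l : List (List β)) (m : List β),
      l.foldl (fun r b => r ++ b) m = m ++ l.flatten := by
    intro l
    induction l with
    | nil => simp
    | cons b l ih => intro m; simp [ih]
  refine (PolyTime.foldl (s := fun _ r b => r ++ b)
    (.append (PolyTime.fst.comp .snd) (PolyTime.snd.comp .snd)) hf (.const [])
    hf.polyBound fun c l hl => ?_).congr fun c => by rw [key, List.nil_append]
  rw [key, List.nil_append]
  exact (sz_flatten_le l).trans (sz_prefix hl)

theorem PolyTime.flatMap {s : α → β → List γ} {f : α → List β}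
    (hs : PolyTime (fun p : α × β => s p.1 p.2)) (hf : PolyTime f) :
    PolyTime (fun a => (f a).flatMap (s a)) :=
  (hs.map hf).flatten.congr fun a => by rw [List.flatMap_def]

theorem PolyTime.filter {s : α → β → Bool} {f : α → List β}
    (hs : PolyTime (fun p : α × β => s p.1 p.2)) (hf : PolyTime f) :
    PolyTime (fun a => (f a).filter (s a)) := by
  refine (PolyTime.flatMap (s := fun a b => if s a b then [b] else [])
    (hs.ite (.cons .snd (.const [])) (.const [])) hf).congr fun a => ?_
  induction f a with
  | nil => rfl
  | cons b l ih =>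
    rw [List.flatMap_cons, ih]
    cases h : s a b <;> simp [h]

theorem PolyTime.all {s : α → β → Bool} {f : α → List β}
    (hs : PolyTime (fun p : α × β => s p.1 p.2)) (hf : PolyTime f) :
    PolyTime (fun a => (f a).all (s a)) := by
  refine (PolyTime.filter (s := fun a b => !s a b) hs.not hf).isEmpty.congr fun a => ?_
  rw [Bool.eq_iff_iff]
  simp

theorem PolyTime.range {f : α → ℕ} (hf : PolyTime f) : PolyTime (fun a => List.range (f a)) := by
  have key : ∀ j : ℕ, (fun l : List ℕ => l ++ [l.length])^[j] [] = List.range j := by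
    intro j
    induction j with
    | zero => rfl
    | succ j ih => rw [Function.iterate_succ_apply', ih, List.length_range, List.range_succ]
  refine (PolyTime.iterate (s := fun _ (l : List ℕ) => l ++ [l.length])
    (.append .snd (.cons (.length .snd) (.const []))) hf (.const [])
    ((hf.polyBound.mul (hf.polyBound.add (.const 1))).add (.const 1)) fun c j hj => ?_).congr
    fun c => key _
  rw [key]
  have h1 : ∀ i ∈ List.range j, sz i ≤ sz (f c) := fun i hi => by
    have := List.mem_range.1 hi
    rw [sz_nat, sz_nat]
    omega
  refine (sz_list_le h1).trans (Nat.add_le_add_right (Nat.mul_le_mul_right _ ?_) 1)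
  rw [List.length_range, sz_nat]
  omega

theorem PolyTime.getD {f : α → List ℕ} {g : α → ℕ} (hf : PolyTime f) (hg : PolyTime g) :
    PolyTime (fun a => (f a).getD (g a) 0) :=
  ((hg.drop hf).headD 0 rfl).congr fun a => by
    rw [List.headD_eq_head?_getD, List.head?_drop, List.getD_eq_getElem?_getD]

theorem PolyTime.eqList {f g : α → List ℕ} (hf : PolyTime f) (hg : PolyTime g) :
    PolyTime (fun a => decide (f a = g a)) := by
  -- Once the lengths agree, all indices that are compared are in range in both lists and the
  -- default `0` plays no role.
  refine ((hf.length.eq hg.length).and (PolyTime.all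
    (s := fun a i => decide ((f a).getD i 0 = (g a).getD i 0))
    (((hf.comp .fst).getD .snd).eq ((hg.comp .fst).getD .snd)) hf.length.range)).congr fun a => ?_
  rw [Bool.eq_iff_iff]
  simp only [Bool.and_eq_true, decide_eq_true_eq, List.all_eq_true, List.mem_range]
  refine ⟨fun ⟨h1, h2⟩ => List.ext_getElem h1 fun i hi hi' => ?_, fun h => by simp [h]⟩
  simpa [List.getD_eq_getElem?_getD, hi, hi'] using h2 i hi

end functions

/-! ### Edits -/

section edits

variable {α : Type}

theorem EditStep.symm {x y : List α} (h : EditStep x y) : EditStep y x := by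
  cases h with
  | insert u v a => exact .delete u v a
  | delete u v a => exact .insert u v a

theorem WithinEdits.mono {j k : ℕ} {x y : List α} (h : WithinEdits j x y) (hjk : j ≤ k) :
    WithinEdits k x y := by
  induction h generalizing k with
  | refl j x => exact .refl k x
  | step hs _ ih =>
    obtain ⟨k, rfl⟩ := Nat.exists_eq_add_of_le' (show 1 ≤ k by omega)
    exact .step hs (ih (by omega))

theorem WithinEdits.trans {j k : ℕ} {x y z : List α} (h : WithinEdits j x y)
    (h' : WithinEdits k y z) : WithinEdits (j + k) x z := by
  induction h with
  | refl j x => exact h'.mono (by omega)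
  | @step j x y _ hs _ ih =>
    rw [show j + 1 + k = j + k + 1 by omega]
    exact .step hs (ih h')

theorem WithinEdits.symm {k : ℕ} {x y : List α} (h : WithinEdits k x y) : WithinEdits k y x := by
  induction h with
  | refl k x => exact .refl k x
  | step hs _ ih => exact ih.trans (.step hs.symm (.refl 0 _))

theorem WithinEdits.eq_of_zero {x y : List α} (h : WithinEdits 0 x y) : x = y := by
  cases h; rfl

theorem withinEdits_succ_iff {k : ℕ} {x z : List α} :
    WithinEdits (k + 1) x z ↔ ∃ y, (y = x ∨ EditStep x y) ∧ WithinEdits k y z := by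
  constructor
  · intro h
    cases h with
    | refl => exact ⟨x, .inl rfl, .refl k x⟩
    | step hs h => exact ⟨_, .inr hs, h⟩
  · rintro ⟨y, rfl | hs, h⟩
    · exact h.mono (Nat.le_succ k)
    · exact .step hs h

theorem WithinEdits.length_le {k : ℕ} {x y : List α} (h : WithinEdits k x y) :
    y.length ≤ x.length + k := by
  induction h with
  | refl => omega
  | step hs _ ih => cases hs <;> simp only [List.length_append, List.length_cons] at * <;> omega

end edits

/-- The strings obtained from `x` by at most one edit over the alphabet `{0, …, q - 1}`. -/
def edits (q : ℕ) (x : List ℕ) : List (List ℕ) :=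
  x :: ((List.range x.length).map (fun i => x.take i ++ x.drop (i + 1)) ++
    (List.range (x.length + 1)).flatMap fun i =>
      (List.range q).map fun a => x.take i ++ a :: x.drop i)

/-- The strings obtained from `x` by at most `j` edits over the alphabet `{0, …, q - 1}`. -/
def ball (q : ℕ) : ℕ → List ℕ → List (List ℕ)
  | 0, x => [x]
  | j + 1, x => (edits q x).flatMap (ball q j)

/-- The algorithms work on lists of naturals because `q` is part of their input. This and `mem_ball`
carry results over to strings over `Fin q`. -/
theorem mem_edits {q : ℕ} {x : List (Fin q)} {z : List ℕ} :
    z ∈ edits q (x.map Fin.val) ↔ ∃ y, (y = x ∨ EditStep x y) ∧ y.map Fin.val = z := by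
  simp only [edits, List.mem_cons, List.mem_append, List.mem_map, List.mem_flatMap, List.mem_range,
    List.length_map]
  constructor
  · rintro (rfl | ⟨i, hi, rfl⟩ | ⟨i, hi, a, ha, rfl⟩)
    · exact ⟨x, .inl rfl, rfl⟩
    · refine ⟨x.take i ++ x.drop (i + 1), .inr ?_, by simp [List.map_take, List.map_drop]⟩
      have := EditStep.delete (x.take i) (x.drop (i + 1)) x[i]
      rwa [← List.drop_eq_getElem_cons hi, List.take_append_drop] at this
    · refine ⟨x.take i ++ ⟨a, ha⟩ :: x.drop i, .inr ?_, by simp [List.map_take, List.map_drop]⟩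
      have := EditStep.insert (x.take i) (x.drop i) ⟨a, ha⟩
      rwa [List.take_append_drop] at this
  · rintro ⟨y, rfl | hs, rfl⟩
    · exact .inl rfl
    · cases hs with
      | insert u v a =>
        refine .inr (.inr ⟨u.length, by simp only [List.length_append]; omega, a, a.2, ?_⟩)
        simp
      | delete u v a =>
        refine .inr (.inl ⟨u.length,
          by simp only [List.length_append, List.length_cons]; omega, ?_⟩)
        simp [List.drop_append]

theorem mem_ball {q j : ℕ} {x : List (Fin q)} {z : List ℕ} :
    z ∈ ball q j (x.map Fin.val) ↔ ∃ y, WithinEdits j x y ∧ y.map Fin.val = z := by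
  induction j generalizing x z with
  | zero =>
    rw [ball, List.mem_singleton]
    constructor
    · rintro rfl
      exact ⟨x, .refl 0 x, rfl⟩
    · rintro ⟨y, h, rfl⟩
      rw [h.eq_of_zero]
  | succ j ih =>
    simp only [ball, List.mem_flatMap, mem_edits, withinEdits_succ_iff]
    constructor
    · rintro ⟨_, ⟨y, hy, rfl⟩, hz⟩
      obtain ⟨w, hw, rfl⟩ := ih.1 hz
      exact ⟨w, ⟨y, hy, hw⟩, rfl⟩
    · rintro ⟨z, ⟨y, hy, hz⟩, rfl⟩
      exact ⟨_, ⟨y, hy, rfl⟩, ih.2 ⟨z, hz, rfl⟩⟩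

/-- There are `q` insertions at each of `x.length + 1` places; the deletions and `x` itself number
`x.length + 1`, which is at most as many because `q ≥ 1`. -/
theorem length_edits_le {q : ℕ} (hq : 0 < q) (x : List ℕ) :
    (edits q x).length ≤ 2 * (x.length + 1) * q := by
  simp only [edits, List.length_cons, List.length_append, List.length_map, List.length_range,
    List.length_flatMap, List.map_const', List.sum_replicate, smul_eq_mul]
  nlinarith

theorem length_of_mem_edits {q : ℕ} {x z : List ℕ} (h : z ∈ edits q x) :
    z.length ≤ x.length + 1 := by
  simp only [edits, List.mem_cons, List.mem_append, List.mem_map, List.mem_flatMap,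
    List.mem_range] at h
  rcases h with rfl | ⟨i, hi, rfl⟩ | ⟨i, hi, a, ha, rfl⟩
  · omega
  · simp only [List.length_append, List.length_take, List.length_drop]; omega
  · simp only [List.length_append, List.length_take, List.length_drop, List.length_cons]; omega

theorem length_flatMap_le {α β : Type*} {f : α → List β} {l : List α} {B : ℕ}
    (h : ∀ a ∈ l, (f a).length ≤ B) : (l.flatMap f).length ≤ l.length * B := by
  induction l with
  | nil => simp
  | cons a l ih =>
    have h1 := h a (by simp)
    have h2 := ih fun b hb => h b (by simp [hb])
    rw [List.flatMap_cons, List.length_append, List.length_cons, add_mul]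
    omega

theorem length_ball_le {q : ℕ} (hq : 0 < q) (j : ℕ) (x : List ℕ) :
    (ball q j x).length ≤ (2 * (x.length + j) * q) ^ j := by
  induction j generalizing x with
  | zero => simp [ball]
  | succ j ih =>
    have h : ∀ z ∈ edits q x, (ball q j z).length ≤ (2 * (x.length + (j + 1)) * q) ^ j :=
      fun z hz => (ih z).trans (Nat.pow_le_pow_left (Nat.mul_le_mul_right _
        (by have := length_of_mem_edits hz; omega)) j)
    refine (length_flatMap_le h).trans ?_
    rw [pow_succ']
    refine Nat.mul_le_mul_right _ ((length_edits_le hq x).trans (Nat.mul_le_mul_right _ ?_))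
    omega

theorem PolyTime.edits : PolyTime (fun p : ℕ × List ℕ => edits p.1 p.2) := by
  have hx : PolyTime (fun p : ℕ × List ℕ => p.2) := .snd
  have h1 : PolyTime (fun p : (ℕ × List ℕ) × ℕ => p.1.2.take p.2 ++ p.1.2.drop (p.2 + 1)) :=
    (PolyTime.take .snd (hx.comp .fst)).append (PolyTime.drop (.succ .snd) (hx.comp .fst))
  have h2 : PolyTime (fun p : ((ℕ × List ℕ) × ℕ) × ℕ =>
      p.1.1.2.take p.1.2 ++ p.2 :: p.1.1.2.drop p.1.2) :=
    (PolyTime.take (PolyTime.snd.comp .fst) (hx.comp (PolyTime.fst.comp .fst))).append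
      (PolyTime.snd.cons
        (PolyTime.drop (PolyTime.snd.comp .fst) (hx.comp (PolyTime.fst.comp .fst))))
  exact hx.cons ((PolyTime.map (s := fun p i => p.2.take i ++ p.2.drop (i + 1)) h1
    hx.length.range).append (PolyTime.flatMap
      (s := fun p i => (List.range p.1).map fun a => p.2.take i ++ a :: p.2.drop i)
      (PolyTime.map (s := fun (p : (ℕ × List ℕ) × ℕ) a => p.1.2.take p.2 ++ a :: p.1.2.drop p.2)
        h2 (PolyTime.fst.comp .fst).range) hx.length.succ.range))

/-- The induction on `j` builds a separate program for each `j`, with a polynomial depending on `j`;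
this is where `k` has to be fixed. -/
theorem PolyTime.ball (j : ℕ) : PolyTime (fun p : ℕ × List ℕ => ball p.1 j p.2) := by
  induction j with
  | zero => exact PolyTime.snd.cons (.const [])
  | succ j ih =>
    exact PolyTime.flatMap (s := fun (p : ℕ × List ℕ) z => EditSyndrome.ball p.1 j z)
      (ih.comp ((PolyTime.fst.comp .fst).prodMk .snd)) .edits

/-! ### Prime numbers -/

/-- The primality test by trial division. -/
def isPrime (p : ℕ) : Bool :=
  decide (2 ≤ p) && (List.range p).all fun m => decide (m < 2) || !decide (p % m = 0)

theorem isPrime_iff {p : ℕ} : isPrime p = true ↔ p.Prime := by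
  rw [isPrime, Nat.prime_def_lt]
  simp only [Bool.and_eq_true, decide_eq_true_eq, List.all_eq_true, List.mem_range, Bool.or_eq_true,
    Bool.not_eq_true', decide_eq_false_iff_not, ← Nat.dvd_iff_mod_eq_zero]
  refine and_congr_right fun hp => forall₂_congr fun m hm => ?_
  rcases Nat.eq_zero_or_pos m with rfl | h0
  · simp only [zero_dvd_iff]; omega
  · constructor
    · rintro (h | h) hd
      · omega
      · exact absurd hd h
    · intro h
      by_cases hd : m ∣ p
      · exact .inl (by have := h hd; omega)
      · exact .inr hd

/-- The first prime number in the interval from `B + 1` to `2 * B`. -/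
def nextPrime (B : ℕ) : ℕ :=
  ((List.range (2 * B + 1)).filter fun p => decide (B < p) && isPrime p).headD 0

theorem headD_mem {α : Type*} {l : List α} (h : l ≠ []) (d : α) : l.headD d ∈ l := by
  cases l with
  | nil => exact absurd rfl h
  | cons a l => simp

/-- Bertrand's postulate makes the search succeed, so the default `0` is not reached. -/
theorem nextPrime_spec {B : ℕ} (hB : B ≠ 0) :
    (nextPrime B).Prime ∧ B < nextPrime B ∧ nextPrime B ≤ 2 * B := by
  obtain ⟨p, hp, h1, h2⟩ := Nat.exists_prime_lt_and_le_two_mul B hB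
  have hmem : p ∈ (List.range (2 * B + 1)).filter fun p => decide (B < p) && isPrime p := by
    simp only [List.mem_filter, List.mem_range, Bool.and_eq_true, decide_eq_true_eq, isPrime_iff]
    exact ⟨by omega, h1, hp⟩
  have h := headD_mem (List.ne_nil_of_mem hmem) 0
  rw [← nextPrime] at h
  simp only [List.mem_filter, List.mem_range, Bool.and_eq_true, decide_eq_true_eq,
    isPrime_iff] at h
  exact ⟨h.2.2, h.2.1, by omega⟩

theorem PolyTime.nextPrime {α : Type} [Enc α] {f : α → ℕ} (hf : PolyTime f) :
    PolyTime (fun a => nextPrime (f a)) := by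
  have h1 : PolyTime isPrime := by
    refine ((PolyTime.const 2).le .id).and (PolyTime.all
      (s := fun p m => decide (m < 2) || !decide (p % m = 0)) ?_ (PolyTime.range .id))
    exact (PolyTime.snd.lt (.const 2)).or (PolyTime.fst.mod .snd).eq_zero.not
  refine PolyTime.comp (f := EditSyndrome.nextPrime) (PolyTime.headD (PolyTime.filter
    (s := fun B p => decide (B < p) && isPrime p) ?_ ?_) 0 rfl) hf
  · exact (PolyTime.fst.lt .snd).and (h1.comp .snd)
  · exact (((PolyTime.const 2).mul .id).succ).range

/-! ### Colouring by polynomials over a prime field -/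

/-- The value at `a`, modulo `p`, of the polynomial with the coefficients `w`. -/
def evalMod (p a : ℕ) (w : List ℕ) : ℕ :=
  w.foldl (fun r s => (r * a + s) % (p - 1 + 1)) 0

/-- The modulus `p - 1 + 1` is positive even for `p = 0`. Hence the accumulator is bounded for all
inputs, as `PolyTime.evalMod` requires, where nothing is known about `p`. -/
theorem foldl_mod_lt (p a : ℕ) (w : List ℕ) {r : ℕ} (hr : r < p - 1 + 1) :
    w.foldl (fun r s => (r * a + s) % (p - 1 + 1)) r < p - 1 + 1 := by
  induction w generalizing r with
  | nil => exact hr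
  | cons s w ih => exact ih (Nat.mod_lt _ (Nat.succ_pos _))

theorem evalMod_lt {p : ℕ} (hp : 0 < p) (a : ℕ) (w : List ℕ) : evalMod p a w < p := by
  have := foldl_mod_lt p a w (Nat.succ_pos (p - 1))
  unfold evalMod
  omega

open Polynomial in
/-- The polynomial with the coefficients `w`, the leading one first. -/
noncomputable def listPoly (R : Type) [CommRing R] : List ℕ → R[X]
  | [] => 0
  | s :: w => C (s : R) * X ^ w.length + listPoly R w

theorem degree_listPoly_lt (R : Type) [CommRing R] (w : List ℕ) :
    (listPoly R w).degree < (w.length : ℕ) := by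
  induction w with
  | nil => simp [listPoly]
  | cons s w ih =>
    refine (Polynomial.degree_add_le _ _).trans_lt (max_lt ?_ (ih.trans ?_))
    · refine (Polynomial.degree_C_mul_X_pow_le _ _).trans_lt ?_
      exact_mod_cast Nat.lt_succ_self _
    · exact_mod_cast Nat.lt_succ_self _

/-- Compare leading coefficients and induct. Equal lengths exclude padding by leading zeros, and
entries below `p` are determined by their residues. -/
theorem listPoly_injOn {p : ℕ} {w z : List ℕ} (hlen : w.length = z.length)
    (hw : ∀ s ∈ w, s < p) (hz : ∀ s ∈ z, s < p)
    (h : listPoly (ZMod p) w = listPoly (ZMod p) z) : w = z := by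
  induction w generalizing z with
  | nil => exact (List.length_eq_zero_iff.1 hlen.symm).symm
  | cons s w ih =>
    cases z with
    | nil => simp at hlen
    | cons t z =>
      have hl : w.length = z.length := by simpa using hlen
      have hc := congrArg (fun P => P.coeff w.length) h
      simp only [listPoly, Polynomial.coeff_add, Polynomial.coeff_C_mul_X_pow, hl, if_true,
        Polynomial.coeff_eq_zero_of_degree_lt (hl ▸ degree_listPoly_lt (ZMod p) w),
        Polynomial.coeff_eq_zero_of_degree_lt (degree_listPoly_lt (ZMod p) z), add_zero] at hc
      have hst : s = t := by
        rw [ZMod.natCast_eq_natCast_iff] at hc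
        exact Nat.ModEq.eq_of_lt_of_lt hc (hw s (by simp)) (hz t (by simp))
      subst hst
      simp only [listPoly, hl] at h
      rw [ih hl (fun s hs => hw s (by simp [hs])) (fun s hs => hz s (by simp [hs]))
        (add_left_cancel h)]

theorem evalMod_cast {p : ℕ} (hp : 0 < p) (a : ℕ) (w : List ℕ) :
    (evalMod p a w : ZMod p) = (listPoly (ZMod p) w).eval (a : ZMod p) := by
  -- Horner's scheme, with the starting value generalized for the induction.
  have key : ∀ (w : List ℕ) (r : ℕ),
      ((w.foldl (fun r s => (r * a + s) % p) r : ℕ) : ZMod p) =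
        r * (a : ZMod p) ^ w.length + (listPoly (ZMod p) w).eval (a : ZMod p) := by
    intro w
    induction w with
    | nil => simp [listPoly]
    | cons s w ih =>
      intro r
      rw [List.foldl_cons, ih]
      simp only [ZMod.natCast_mod, Nat.cast_add, Nat.cast_mul, listPoly, List.length_cons,
        Polynomial.eval_add, Polynomial.eval_mul, Polynomial.eval_C, Polynomial.eval_pow,
        Polynomial.eval_X]
      ring
  rw [evalMod, Nat.sub_add_cancel hp, key]
  simp

/-- Points of agreement are roots of the difference, a nonzero polynomial of degree at most `L` over
a field. -/
theorem card_agree_le {p L : ℕ} (hp : p.Prime) {w z : List ℕ} (hwL : w.length = L)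
    (hzL : z.length = L) (hw : ∀ s ∈ w, s < p) (hz : ∀ s ∈ z, s < p) (hne : w ≠ z) :
    ((Finset.range p).filter fun a => evalMod p a w = evalMod p a z).card ≤ L := by
  have := Fact.mk hp
  set D := listPoly (ZMod p) w - listPoly (ZMod p) z with hD
  have hD0 : D ≠ 0 := fun h =>
    hne (listPoly_injOn (hwL.trans hzL.symm) hw hz (sub_eq_zero.1 h))
  have hdeg : D.natDegree ≤ L := by
    refine Polynomial.natDegree_le_of_degree_le ((Polynomial.degree_sub_le _ _).trans ?_)
    exact max_le (hwL ▸ (degree_listPoly_lt _ w).le) (hzL ▸ (degree_listPoly_lt _ z).le)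
  refine le_trans ?_ (((Multiset.toFinset_card_le _).trans (Polynomial.card_roots' D)).trans hdeg)
  refine Finset.card_le_card_of_injOn (fun a => (a : ZMod p)) ?_ ?_
  · intro a ha
    rw [Finset.mem_coe, Finset.mem_filter] at ha
    rw [Finset.mem_coe, Multiset.mem_toFinset, Polynomial.mem_roots hD0, Polynomial.IsRoot.def, hD,
      Polynomial.eval_sub, ← evalMod_cast hp.pos, ← evalMod_cast hp.pos, ha.2, sub_self]
  · intro a ha b hb hab
    rw [Finset.mem_coe, Finset.mem_filter, Finset.mem_range] at ha hb
    rw [ZMod.natCast_eq_natCast_iff] at hab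
    exact Nat.ModEq.eq_of_lt_of_lt hab ha.1 hb.1

/-- The first point at which the polynomial of `x` differs from those of the other members
of `l`. -/
def pick (p : ℕ) (l : List (List ℕ)) (x : List ℕ) : ℕ :=
  ((List.range p).filter fun a =>
    l.all fun z => decide (z = x) || !decide (evalMod p a z = evalMod p a x)).headD 0

theorem pick_spec {p L : ℕ} (hp : p.Prime) {l : List (List ℕ)} {x : List ℕ}
    (hxL : x.length = L) (hx : ∀ s ∈ x, s < p) (hlL : ∀ z ∈ l, z.length = L)
    (hl : ∀ z ∈ l, ∀ s ∈ z, s < p) (hcard : l.length * L < p) :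
    pick p l x < p ∧ ∀ z ∈ l, z ≠ x → evalMod p (pick p l x) z ≠ evalMod p (pick p l x) x := by
  have hex : ∃ a < p, ∀ z ∈ l, z ≠ x → evalMod p a z ≠ evalMod p a x := by
    by_contra! hcon
    -- Union bound: if no point were good, the `p` points would be covered by at most `l.length`
    -- sets of at most `L` points each.
    have hsub : Finset.range p ⊆ (l.toFinset.filter (· ≠ x)).biUnion fun z =>
        (Finset.range p).filter fun a => evalMod p a z = evalMod p a x := by
      intro a ha
      obtain ⟨z, hz, hne, he⟩ := hcon a (Finset.mem_range.1 ha)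
      simp only [Finset.mem_biUnion, Finset.mem_filter, List.mem_toFinset]
      exact ⟨z, ⟨hz, hne⟩, ha, he⟩
    have h1 := (Finset.card_le_card hsub).trans (Finset.card_biUnion_le_card_mul _ _ L ?_)
    · rw [Finset.card_range] at h1
      have h2 := (Finset.card_filter_le l.toFinset (· ≠ x)).trans (List.toFinset_card_le l)
      have h3 := Nat.mul_le_mul_right L h2
      omega
    · intro z hz
      rw [Finset.mem_filter, List.mem_toFinset] at hz
      exact card_agree_le hp (hlL z hz.1) hxL (hl z hz.1) hx hz.2
  have key : ∀ a, a ∈ (List.range p).filter (fun a =>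
      l.all fun z => decide (z = x) || !decide (evalMod p a z = evalMod p a x)) ↔
      a < p ∧ ∀ z ∈ l, z ≠ x → evalMod p a z ≠ evalMod p a x := by
    intro a
    simp only [List.mem_filter, List.mem_range, List.all_eq_true, Bool.or_eq_true,
      decide_eq_true_eq, Bool.not_eq_true', decide_eq_false_iff_not, or_iff_not_imp_left, ne_eq]
  obtain ⟨a, ha⟩ := hex
  exact (key _).1 (headD_mem (List.ne_nil_of_mem ((key a).2 ha)) 0)

/-- The colour of `x` that is to differ from those of the other members of `l`: a point and the
value at this point. -/
def colour (p : ℕ) (l : List (List ℕ)) (x : List ℕ) : ℕ × ℕ :=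
  (pick p l x, evalMod p (pick p l x) x)

/-- Only the choice of the point for `x` matters: if the points coincide, the values there differ.
Therefore `m` is arbitrary. -/
theorem colour_ne {p L : ℕ} (hp : p.Prime) {l m : List (List ℕ)} {x z : List ℕ}
    (hxL : x.length = L) (hx : ∀ s ∈ x, s < p) (hlL : ∀ z ∈ l, z.length = L)
    (hl : ∀ z ∈ l, ∀ s ∈ z, s < p) (hcard : l.length * L < p) (hz : z ∈ l) (hne : z ≠ x) :
    colour p l x ≠ colour p m z := by
  intro h
  rw [colour, colour, Prod.mk.injEq] at h
  refine (pick_spec hp hxL hx hlL hl hcard).2 z hz hne ?_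
  rw [h.2, h.1]

theorem PolyTime.evalMod {α : Type} [Enc α] {f g : α → ℕ} {h : α → List ℕ} (hf : PolyTime f)
    (hg : PolyTime g) (hh : PolyTime h) : PolyTime (fun a => evalMod (f a) (g a) (h a)) := by
  refine PolyTime.foldl (s := fun c r s => (r * g c + s) % (f c - 1 + 1)) ?_ hh (.const 0)
    (hf.polyBound.add (.const 2)) fun c l hl => ?_
  · exact (((PolyTime.fst.comp .snd).mul (hg.comp .fst)).add (PolyTime.snd.comp .snd)).mod
      ((hf.comp .fst).sub (.const 1)).succ
  · have := foldl_mod_lt (f c) (g c) l (Nat.succ_pos (f c - 1))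
    rw [sz_nat, sz_nat]
    omega

theorem PolyTime.colour {α : Type} [Enc α] {f : α → ℕ} {g : α → List (List ℕ)} {h : α → List ℕ}
    (hf : PolyTime f) (hg : PolyTime g) (hh : PolyTime h) :
    PolyTime (fun a => colour (f a) (g a) (h a)) := by
  have hpick : PolyTime (fun a => pick (f a) (g a) (h a)) := by
    refine PolyTime.headD (PolyTime.filter (s := fun c a => (g c).all fun z =>
      decide (z = h c) || !decide (EditSyndrome.evalMod (f c) a z =
        EditSyndrome.evalMod (f c) a (h c))) ?_ hf.range) 0 rfl
    refine PolyTime.all (s := fun (c : α × ℕ) z => decide (z = h c.1) ||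
      !decide (EditSyndrome.evalMod (f c.1) c.2 z =
        EditSyndrome.evalMod (f c.1) c.2 (h c.1))) ?_ (hg.comp .fst)
    have h1 : PolyTime (fun p : (α × ℕ) × List ℕ => p.1.1) := PolyTime.fst.comp .fst
    have h2 : PolyTime (fun p : (α × ℕ) × List ℕ => p.1.2) := PolyTime.snd.comp .fst
    exact (PolyTime.snd.eqList (hh.comp h1)).or (((hf.comp h1).evalMod h2 .snd).eq
      ((hf.comp h1).evalMod h2 (hh.comp h1))).not
  exact hpick.prodMk (hf.evalMod hpick hh)

/-! ### The syndrome -/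

/-- A bound for the number of strings within `2 * k` edits of a string of length `n`. -/
def ballBound (k n q : ℕ) : ℕ := (2 * (n + 2 * k + 1) * q) ^ (2 * k)

/-- The strings of length `n` within `2 * k` edits of `x`. -/
def neighbours (k n q : ℕ) (x : List ℕ) : List (List ℕ) :=
  (ball q (2 * k) x).filter fun z => decide (z.length = n)

/-- A colouring with polynomially many colours that separates each string from its neighbours. -/
def firstColour (k n q : ℕ) (x : List ℕ) : List ℕ :=
  let c := colour (nextPrime (ballBound k n q * (n + 1))) (neighbours k n q x) x
  [c.1 / ballBound k n q, c.1 % ballBound k n q, c.2 / ballBound k n q, c.2 % ballBound k n q]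

/-- The prime number whose square is the number of values of the syndrome. -/
def syndromePrime (k n q : ℕ) : ℕ := nextPrime (ballBound k n q * 4)

/-- The syndrome before its two components are combined. -/
def syndromePair (k n q : ℕ) (x : List ℕ) : ℕ × ℕ :=
  colour (syndromePrime k n q) ((neighbours k n q x).map (firstColour k n q)) (firstColour k n q x)

/-- The syndrome. -/
def syndrome (k n q : ℕ) (x : List ℕ) : ℕ :=
  (syndromePair k n q x).1 * syndromePrime k n q + (syndromePair k n q x).2

/-- The string of length `n` with the syndrome `s` within `k` edits of `y`. -/
def recover (k n q : ℕ) (y : List ℕ) (s : ℕ) : List ℕ :=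
  ((ball q k y).filter fun z => decide (z.length = n) && decide (syndrome k n q z = s)).headD []

/-! ### The syndrome is a proper colouring. -/

section correctness

variable {k n q : ℕ}

theorem ballBound_pos (k n : ℕ) (hq : 0 < q) : 0 < ballBound k n q := by
  unfold ballBound; positivity

/-- This is where `k ≠ 0` enters: for `k = 0` the right side is `1`. It gives `2 * N * (n + 1) ≤ N ^
2` in `firstPrime_spec`, so that each component of the first colour has two digits in base `N`. -/
theorem le_ballBound (hk : k ≠ 0) : 2 * (n + 1) * q ≤ ballBound k n q := by
  refine le_trans ?_ (Nat.le_self_pow (by omega) _)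
  exact Nat.mul_le_mul_right _ (by omega)

theorem length_neighbours_le (hq : 0 < q) {x : List ℕ} (hx : x.length = n) :
    (neighbours k n q x).length ≤ ballBound k n q := by
  refine (List.length_filter_le _ _).trans ((length_ball_le hq (2 * k) x).trans ?_)
  rw [hx]
  exact Nat.pow_le_pow_left (Nat.mul_le_mul_right _ (by omega)) _

theorem mem_neighbours {x : List (Fin q)} {z : List ℕ} :
    z ∈ neighbours k n q (x.map Fin.val) ↔
      ∃ y : List (Fin q), y.length = n ∧ WithinEdits (2 * k) x y ∧ y.map Fin.val = z := by
  simp only [neighbours, List.mem_filter, mem_ball, decide_eq_true_eq]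
  constructor
  · rintro ⟨⟨y, hy, rfl⟩, hl⟩
    exact ⟨y, by simpa using hl, hy, rfl⟩
  · rintro ⟨y, hl, hy, rfl⟩
    exact ⟨⟨y, hy, rfl⟩, by simpa using hl⟩

theorem val_lt {x : List (Fin q)} {s : ℕ} (hs : s ∈ x.map Fin.val) : s < q := by
  obtain ⟨a, -, rfl⟩ := List.mem_map.1 hs
  exact a.2

theorem firstPrime_spec (hk : k ≠ 0) (hq : 0 < q) :
    (nextPrime (ballBound k n q * (n + 1))).Prime ∧
      ballBound k n q * (n + 1) < nextPrime (ballBound k n q * (n + 1)) ∧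
      nextPrime (ballBound k n q * (n + 1)) ≤ ballBound k n q * ballBound k n q := by
  have h0 := ballBound_pos k n hq
  obtain ⟨h1, h2, h3⟩ := nextPrime_spec (B := ballBound k n q * (n + 1)) (by positivity)
  refine ⟨h1, h2, h3.trans ?_⟩
  rw [mul_left_comm]
  have := le_ballBound (n := n) (q := q) hk
  exact Nat.mul_le_mul_left _ (by nlinarith)

theorem le_firstPrime (hk : k ≠ 0) (hq : 0 < q) :
    q ≤ nextPrime (ballBound k n q * (n + 1)) := by
  have := le_ballBound (n := n) (q := q) hk
  have := (firstPrime_spec (n := n) hk hq).2.1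
  nlinarith

theorem syndromePrime_spec (k n : ℕ) (hq : 0 < q) :
    (syndromePrime k n q).Prime ∧ ballBound k n q * 4 < syndromePrime k n q ∧
      syndromePrime k n q ≤ 8 * ballBound k n q := by
  have h0 := ballBound_pos k n hq
  obtain ⟨h1, h2, h3⟩ := nextPrime_spec (B := ballBound k n q * 4) (by positivity)
  exact ⟨h1, h2, h3.trans (by omega)⟩

theorem separates_neighbours (hk : k ≠ 0) (hq : 0 < q) {x : List (Fin q)} (hx : x.length = n) :
    (∀ z ∈ neighbours k n q (x.map Fin.val), z.length = n) ∧
    (∀ z ∈ neighbours k n q (x.map Fin.val), ∀ s ∈ z,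
      s < nextPrime (ballBound k n q * (n + 1))) ∧
    (neighbours k n q (x.map Fin.val)).length * n < nextPrime (ballBound k n q * (n + 1)) := by
  refine ⟨fun z hz => ?_, fun z hz s hs => ?_, ?_⟩
  · obtain ⟨y, hl, -, rfl⟩ := mem_neighbours.1 hz
    simpa using hl
  · obtain ⟨y, -, -, rfl⟩ := mem_neighbours.1 hz
    exact (val_lt hs).trans_le (le_firstPrime hk hq)
  · refine (Nat.mul_le_mul (length_neighbours_le hq (by simpa using hx)) (Nat.le_succ n)).trans_lt
      (firstPrime_spec hk hq).2.1

theorem firstColour_lt (hk : k ≠ 0) (hq : 0 < q) {x : List (Fin q)} (hx : x.length = n) :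
    ∀ s ∈ firstColour k n q (x.map Fin.val), s < ballBound k n q := by
  have h0 := ballBound_pos k n hq
  obtain ⟨hp, -, hle⟩ := firstPrime_spec (n := n) hk hq
  obtain ⟨h1, h2, h3⟩ := separates_neighbours hk hq hx
  have hpick := (pick_spec hp (by simpa using hx)
    (fun s hs => (val_lt hs).trans_le (le_firstPrime hk hq)) h1 h2 h3).1
  have hev := evalMod_lt hp.pos (pick (nextPrime (ballBound k n q * (n + 1)))
    (neighbours k n q (x.map Fin.val)) (x.map Fin.val)) (x.map Fin.val)
  simp only [firstColour, colour, List.mem_cons, List.not_mem_nil, or_false, forall_eq_or_imp,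
    forall_eq]
  exact ⟨Nat.div_lt_of_lt_mul (hpick.trans_le hle), Nat.mod_lt _ h0,
    Nat.div_lt_of_lt_mul (hev.trans_le hle), Nat.mod_lt _ h0⟩

theorem eq_of_divMod_eq {a b N : ℕ} (h : a / N = b / N) (h' : a % N = b % N) : a = b := by
  rw [← Nat.div_add_mod a N, ← Nat.div_add_mod b N, h, h']

theorem firstColour_ne (hk : k ≠ 0) (hq : 0 < q) {x y : List (Fin q)} (hx : x.length = n)
    (hy : y.length = n) (h : WithinEdits (2 * k) x y) (hne : y ≠ x) :
    firstColour k n q (x.map Fin.val) ≠ firstColour k n q (y.map Fin.val) := by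
  obtain ⟨h1, h2, h3⟩ := separates_neighbours hk hq hx
  have hc := colour_ne (m := neighbours k n q (y.map Fin.val)) (firstPrime_spec hk hq).1
    (by simpa using hx) (fun s hs => (val_lt hs).trans_le (le_firstPrime hk hq)) h1 h2 h3
    (mem_neighbours.2 ⟨y, hy, h, rfl⟩)
    (fun h => hne ((List.map_injective_iff.2 Fin.val_injective) h))
  intro he
  simp only [firstColour, List.cons.injEq, and_true] at he
  exact hc (Prod.ext (eq_of_divMod_eq he.1 he.2.1) (eq_of_divMod_eq he.2.2.1 he.2.2.2))

theorem separates_colours (hk : k ≠ 0) (hq : 0 < q) {x : List (Fin q)} (hx : x.length = n) :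
    (∀ s ∈ firstColour k n q (x.map Fin.val), s < syndromePrime k n q) ∧
    (∀ z ∈ (neighbours k n q (x.map Fin.val)).map (firstColour k n q), z.length = 4) ∧
    (∀ z ∈ (neighbours k n q (x.map Fin.val)).map (firstColour k n q), ∀ s ∈ z,
      s < syndromePrime k n q) ∧
    ((neighbours k n q (x.map Fin.val)).map (firstColour k n q)).length * 4 <
      syndromePrime k n q := by
  have hp := (syndromePrime_spec k n hq).2.1
  have hlt : ∀ y : List (Fin q), y.length = n →
      ∀ s ∈ firstColour k n q (y.map Fin.val), s < syndromePrime k n q := fun y hy s hs => by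
    have := firstColour_lt hk hq hy s hs
    omega
  refine ⟨hlt x hx, fun z hz => ?_, fun z hz => ?_, ?_⟩
  · obtain ⟨w, -, rfl⟩ := List.mem_map.1 hz
    rfl
  · obtain ⟨w, hw, rfl⟩ := List.mem_map.1 hz
    obtain ⟨y, hl, -, rfl⟩ := mem_neighbours.1 hw
    exact hlt y hl
  · rw [List.length_map]
    exact (Nat.mul_le_mul_right _ (length_neighbours_le hq (by simpa using hx))).trans_lt hp

theorem syndromePair_lt (hk : k ≠ 0) (hq : 0 < q) {x : List (Fin q)} (hx : x.length = n) :
    (syndromePair k n q (x.map Fin.val)).1 < syndromePrime k n q ∧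
      (syndromePair k n q (x.map Fin.val)).2 < syndromePrime k n q := by
  obtain ⟨h0, h1, h2, h3⟩ := separates_colours hk hq hx
  have hp := (syndromePrime_spec k n hq).1
  exact ⟨(pick_spec hp rfl h0 h1 h2 h3).1, evalMod_lt hp.pos _ _⟩

theorem syndrome_lt (hk : k ≠ 0) (hq : 0 < q) {x : List (Fin q)} (hx : x.length = n) :
    syndrome k n q (x.map Fin.val) < syndromePrime k n q ^ 2 := by
  obtain ⟨h1, h2⟩ := syndromePair_lt hk hq hx
  unfold syndrome
  nlinarith

theorem syndrome_ne (hk : k ≠ 0) (hq : 0 < q) {x y : List (Fin q)} (hx : x.length = n)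
    (hy : y.length = n) (h : WithinEdits (2 * k) x y) (hne : y ≠ x) :
    syndrome k n q (x.map Fin.val) ≠ syndrome k n q (y.map Fin.val) := by
  obtain ⟨h0, h1, h2, h3⟩ := separates_colours hk hq hx
  have hp := (syndromePrime_spec k n hq).1
  have hc := colour_ne (m := (neighbours k n q (y.map Fin.val)).map (firstColour k n q)) hp rfl
    h0 h1 h2 h3 (List.mem_map_of_mem (mem_neighbours.2 ⟨y, hy, h, rfl⟩))
    (firstColour_ne hk hq hx hy h hne).symm
  intro he
  have hx2 := (syndromePair_lt hk hq hx).2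
  have hy2 := (syndromePair_lt hk hq hy).2
  have hdm : ∀ z, (syndromePair k n q z).2 < syndromePrime k n q →
      syndrome k n q z / syndromePrime k n q = (syndromePair k n q z).1 ∧
        -- Since the second component is below the prime, the pair can be read off from the syndrome
        -- as quotient and remainder.
        syndrome k n q z % syndromePrime k n q = (syndromePair k n q z).2 := fun z hz =>
    (Nat.div_mod_unique hp.pos).2 ⟨by rw [syndrome, mul_comm]; omega, hz⟩
  refine hc (Prod.ext ?_ ?_)
  · exact ((hdm _ hx2).1.symm.trans (by rw [he])).trans (hdm _ hy2).1
  · exact ((hdm _ hx2).2.symm.trans (by rw [he])).trans (hdm _ hy2).2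

/-- Going from `x` to `y` and back to `x'` takes at most `2 * k` edits. -/
theorem eq_of_syndrome_eq (hk : k ≠ 0) (hq : 0 < q) {x x' y : List (Fin q)} (hx : x.length = n)
    (hx' : x'.length = n) (h : WithinEdits k x y) (h' : WithinEdits k x' y)
    (he : syndrome k n q (x.map Fin.val) = syndrome k n q (x'.map Fin.val)) : x = x' := by
  by_contra hne
  exact syndrome_ne hk hq hx hx' ((two_mul k).symm ▸ h.trans h'.symm) (Ne.symm hne) he

theorem recover_eq (hk : k ≠ 0) (hq : 0 < q) {x y : List (Fin q)} (hx : x.length = n)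
    (h : WithinEdits k x y) :
    recover k n q (y.map Fin.val) (syndrome k n q (x.map Fin.val)) = x.map Fin.val := by
  have hmem : x.map Fin.val ∈ (ball q k (y.map Fin.val)).filter fun z =>
      decide (z.length = n) &&
        decide (syndrome k n q z = syndrome k n q (x.map Fin.val)) := by
    simpa [hx, mem_ball] using ⟨x, h.symm, rfl⟩
  have h1 := headD_mem (List.ne_nil_of_mem hmem) []
  rw [← recover] at h1
  simp only [List.mem_filter, mem_ball, Bool.and_eq_true, decide_eq_true_eq] at h1
  obtain ⟨⟨z, hz, he⟩, hl, hs⟩ := h1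
  rw [← he] at hl hs ⊢
  rw [eq_of_syndrome_eq hk hq hx (by simpa using hl) h hz.symm hs.symm]

end correctness

/-! #### Running times -/

section time

variable {α : Type} [Enc α] {f g : α → ℕ} {h : α → List ℕ}

theorem PolyTime.ballBound (k : ℕ) (hf : PolyTime f) (hg : PolyTime g) :
    PolyTime (fun a => ballBound k (f a) (g a)) :=
  (((PolyTime.const 2).mul ((hf.add (.const (2 * k))).succ)).mul hg).pow (2 * k)

theorem PolyTime.neighbours (k : ℕ) (hf : PolyTime f) (hg : PolyTime g) (hh : PolyTime h) :
    PolyTime (fun a => neighbours k (f a) (g a) (h a)) :=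
  PolyTime.filter (s := fun a (z : List ℕ) => decide (z.length = f a))
    ((PolyTime.length .snd).eq (hf.comp .fst)) ((PolyTime.ball (2 * k)).comp (hg.prodMk hh))

theorem PolyTime.firstColour (k : ℕ) (hf : PolyTime f) (hg : PolyTime g) (hh : PolyTime h) :
    PolyTime (fun a => firstColour k (f a) (g a) (h a)) := by
  have hN := PolyTime.ballBound k hf hg
  have hc := PolyTime.colour (hN.mul hf.succ).nextPrime (PolyTime.neighbours k hf hg hh) hh
  have h1 := PolyTime.fst.comp hc
  have h2 := PolyTime.snd.comp hc
  exact (h1.div hN).cons ((h1.mod hN).cons ((h2.div hN).cons ((h2.mod hN).cons (.const []))))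

theorem PolyTime.syndrome (k : ℕ) (hf : PolyTime f) (hg : PolyTime g) (hh : PolyTime h) :
    PolyTime (fun a => syndrome k (f a) (g a) (h a)) := by
  have hp : PolyTime (fun a => syndromePrime k (f a) (g a)) :=
    ((PolyTime.ballBound k hf hg).mul (.const 4)).nextPrime
  have hc := PolyTime.colour hp (PolyTime.map
    (s := fun a z => EditSyndrome.firstColour k (f a) (g a) z)
    (.firstColour k (hf.comp .fst) (hg.comp .fst) .snd) (.neighbours k hf hg hh))
    (.firstColour k hf hg hh)
  exact ((PolyTime.fst.comp hc).mul hp).add (PolyTime.snd.comp hc)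

theorem PolyTime.recover (k : ℕ) {s : α → ℕ} (hf : PolyTime f) (hg : PolyTime g)
    (hh : PolyTime h) (hs : PolyTime s) :
    PolyTime (fun a => recover k (f a) (g a) (h a) (s a)) := by
  refine PolyTime.headD (PolyTime.filter (s := fun a (z : List ℕ) => decide (z.length = f a) &&
    decide (EditSyndrome.syndrome k (f a) (g a) z = s a)) ?_
    ((PolyTime.ball k).comp (hg.prodMk hh))) [] rfl
  exact ((PolyTime.length .snd).eq (hf.comp .fst)).and
    ((PolyTime.syndrome k (hf.comp .fst) (hg.comp .fst) .snd).eq (hs.comp .fst))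

end time

theorem ofString_eq_enc {q : ℕ} (x : List (Fin q)) :
    Data.ofString x = enc (x.map Fin.val) := by
  induction x with
  | nil => rfl
  | cons a x ih => exact congrArg (Data.cons _) ih

theorem syndromeInput_eq_enc (n q : ℕ) (x : List (Fin q)) :
    syndromeInput n q x = enc (n, q, x.map Fin.val) := by
  rw [syndromeInput, ofString_eq_enc]; rfl

theorem recoveryInput_eq_enc (n q : ℕ) (y : List (Fin q)) (s : ℕ) :
    recoveryInput n q y s = enc (n, q, y.map Fin.val, s) := by
  rw [recoveryInput, ofString_eq_enc]; rfl

theorem sz_string_le {q : ℕ} (x : List (Fin q)) :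
    sz (x.map Fin.val) ≤ x.length * (2 * q + 2) + 1 := by
  have h : ∀ s ∈ x.map Fin.val, sz s ≤ 2 * q + 1 := fun s hs => by
    have := val_lt hs
    rw [sz_nat]
    omega
  simpa using sz_list_le h

/-! ### Asymptotics -/

theorem exists_polynomial_bound {q : ℕ → ℕ}
    (hq : ∃ c : ℕ, (fun n : ℕ => (q n : ℝ)) =O[atTop] (fun n : ℕ => (n : ℝ) ^ c)) :
    ∃ Q : Polynomial ℕ, ∀ n, q n ≤ Q.eval n := by
  obtain ⟨c, hc⟩ := hq
  obtain ⟨C, hC⟩ := hc.bound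
  obtain ⟨m, hm⟩ := eventually_atTop.1 hC
  -- The constant term takes care of the finitely many `n` outside the asymptotic range.
  refine ⟨.C ⌈C⌉₊ * .X ^ c + .C (∑ i ∈ Finset.range m, q i), fun n => ?_⟩
  simp only [Polynomial.eval_add, Polynomial.eval_mul, Polynomial.eval_C, Polynomial.eval_pow,
    Polynomial.eval_X]
  rcases lt_or_ge n m with h | h
  · exact le_add_left (Finset.single_le_sum (f := q) (fun i _ => Nat.zero_le _)
      (Finset.mem_range.2 h))
  · refine le_add_right ?_
    have h1 := hm n h
    rw [Real.norm_of_nonneg (by positivity), Real.norm_of_nonneg (by positivity)] at h1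
    have h2 : (q n : ℝ) ≤ (⌈C⌉₊ * n ^ c : ℕ) := by
      push_cast
      exact h1.trans (mul_le_mul_of_nonneg_right (Nat.le_ceil C) (by positivity))
    exact_mod_cast h2

theorem const_isBigO_logb_logb (c : ℝ) :
    (fun _ : ℕ => c) =O[atTop] (fun n : ℕ => Real.logb 2 (Real.logb 2 (n : ℝ))) := by
  have h : Tendsto (fun n : ℕ => Real.logb 2 (Real.logb 2 (n : ℝ))) atTop atTop :=
    (Real.tendsto_logb_atTop one_lt_two).comp
      ((Real.tendsto_logb_atTop one_lt_two).comp tendsto_natCast_atTop_atTop)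
  exact (isLittleO_const_left.2 (.inr (tendsto_norm_atTop_atTop.comp h))).isBigO

theorem syndromePrime_sq_le (k : ℕ) {n q : ℕ} (hn : 1 ≤ n) (hq : 0 < q) :
    ((syndromePrime k n q ^ 2 : ℕ) : ℝ) ≤ (2 : ℝ) ^ (4 * (k : ℝ) * Real.logb 2 (n : ℝ) +
      4 * (k : ℝ) * Real.logb 2 (q : ℝ) + Real.logb 2 (64 * (4 * k + 4) ^ (4 * k))) := by
  have hn0 : (0 : ℝ) < n := by exact_mod_cast hn
  have hq0 : (0 : ℝ) < q := by exact_mod_cast hq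
  have hpow : ∀ x : ℝ, 0 < x → (2 : ℝ) ^ (4 * (k : ℝ) * Real.logb 2 x) = x ^ (4 * k) := by
    intro x hx
    rw [mul_comm, Real.rpow_mul zero_le_two, Real.rpow_logb two_pos (by norm_num) hx,
      ← Real.rpow_natCast]
    push_cast
    rfl
  rw [Real.rpow_add two_pos, Real.rpow_add two_pos, hpow _ hn0, hpow _ hq0,
    Real.rpow_logb two_pos (by norm_num) (by positivity)]
  have h1 : syndromePrime k n q ^ 2 ≤ (8 * ballBound k n q) ^ 2 :=
    Nat.pow_le_pow_left (syndromePrime_spec k n hq).2.2 2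
  -- For `n ≥ 1` one has `n + 2 * k + 1 ≤ (2 * k + 2) * n`.
  have h2 : ballBound k n q ≤ ((4 * k + 4) * n * q) ^ (2 * k) :=
    Nat.pow_le_pow_left (Nat.mul_le_mul_right _ (by nlinarith)) _
  have h3 : syndromePrime k n q ^ 2 ≤
      n ^ (4 * k) * q ^ (4 * k) * (64 * (4 * k + 4) ^ (4 * k)) := by
    refine (h1.trans (Nat.pow_le_pow_left (Nat.mul_le_mul_left 8 h2) 2)).trans_eq ?_
    rw [mul_pow, ← pow_mul, show 2 * k * 2 = 4 * k by ring, mul_pow, mul_pow]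
    ring
  exact_mod_cast h3

/-! ### Programs on strings over `{0, …, q n - 1}` -/

theorem exists_syndrome_program {q : ℕ → ℕ} {Q : Polynomial ℕ} (hQ : ∀ n, q n ≤ Q.eval n)
    {f : ℕ × ℕ × List ℕ → ℕ} (hf : PolyTime f) :
    ∃ (P : Program) (T : Polynomial ℕ), ∀ (n : ℕ) (x : List.Vector (Fin (q n)) n),
      RunsWithin P (syndromeInput n (q n) x.toList)
        (.ofNat (f (n, q n, x.toList.map Fin.val))) (T.eval n) := by
  obtain ⟨P, T, hP⟩ := hf
  refine ⟨P, T.comp (2 * .X + 2 * Q + (.X * (2 * Q + 2) + 1) + 4), fun n x => ?_⟩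
  rw [syndromeInput_eq_enc]
  refine (hP (n, q n, x.toList.map Fin.val)).mono ?_
  rw [Polynomial.eval_comp]
  refine eval_mono T ?_
  have h1 := sz_string_le x.toList
  have h2 := hQ n
  have h3 : n * (2 * q n + 2) ≤ n * (2 * Q.eval n + 2) := by gcongr
  rw [x.toList_length] at h1
  simp only [sz_prod, sz_nat, Polynomial.eval_add, Polynomial.eval_mul, Polynomial.eval_X,
    Polynomial.eval_ofNat, Polynomial.eval_one]
  omega

/-- The syndrome is written in unary, so a polynomial bound `S` on its value is needed to measure
time in terms of `n` alone. -/
theorem exists_recovery_program (k : ℕ) {q : ℕ → ℕ} {Q S : Polynomial ℕ}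
    (hQ : ∀ n, q n ≤ Q.eval n) {g : ℕ × ℕ × List ℕ × ℕ → List ℕ} (hg : PolyTime g) :
    ∃ (R : Program) (T : Polynomial ℕ), ∀ (n : ℕ) (y : List (Fin (q n))) (s : ℕ),
      y.length ≤ n + k → s ≤ S.eval n →
        RunsWithin R (recoveryInput n (q n) y s) (enc (g (n, q n, y.map Fin.val, s)))
          (T.eval n) := by
  obtain ⟨R, T, hR⟩ := hg
  refine ⟨R, T.comp (2 * .X + 2 * Q + ((.X + .C k) * (2 * Q + 2) + 1) + 2 * S + 6),
    fun n y s hy hs => ?_⟩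
  rw [recoveryInput_eq_enc]
  refine (hR (n, q n, y.map Fin.val, s)).mono ?_
  rw [Polynomial.eval_comp]
  refine eval_mono T ?_
  have h1 := sz_string_le y
  have h2 := hQ n
  have h3 : y.length * (2 * q n + 2) ≤ (n + k) * (2 * Q.eval n + 2) := by gcongr
  simp only [sz_prod, sz_nat, Polynomial.eval_add, Polynomial.eval_mul, Polynomial.eval_X,
    Polynomial.eval_ofNat, Polynomial.eval_one, Polynomial.eval_C]
  omega

theorem exists_syndromePrime_sq_bound (k : ℕ) {q : ℕ → ℕ} (hq : ∀ n, 0 < q n) {Q : Polynomial ℕ}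
    (hQ : ∀ n, q n ≤ Q.eval n) :
    ∃ S : Polynomial ℕ, ∀ n, syndromePrime k n (q n) ^ 2 ≤ S.eval n := by
  refine ⟨(8 * (2 * (.X + .C (2 * k) + 1) * Q) ^ (2 * k)) ^ 2, fun n => ?_⟩
  simp only [Polynomial.eval_add, Polynomial.eval_mul, Polynomial.eval_X,
    Polynomial.eval_ofNat, Polynomial.eval_one, Polynomial.eval_C, Polynomial.eval_pow]
  refine Nat.pow_le_pow_left ((syndromePrime_spec k n (hq n)).2.2.trans ?_) 2
  have := hQ n
  unfold ballBound
  gcongr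

end EditSyndrome

theorem mainTheorem2 (k : ℕ) (q : ℕ → ℕ) (hq_pos : ∀ n, 0 < q n)
    (hq_poly : ∃ c : ℕ, (fun n : ℕ => (q n : ℝ)) =O[atTop] (fun n : ℕ => (n : ℝ) ^ c)) :
    ∃ (M : ℕ → ℕ) (Φ : (n : ℕ) → List.Vector (Fin (q n)) n → Fin (M n)),
      (∃ r : ℕ → ℝ,
        r =O[atTop] (fun n : ℕ => Real.logb 2 (Real.logb 2 (n : ℝ))) ∧
        ∀ n : ℕ, 1 ≤ n →
          (M n : ℝ) ≤
            (2 : ℝ) ^ (4 * (k : ℝ) * Real.logb 2 (n : ℝ) +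
              4 * (k : ℝ) * Real.logb 2 (q n : ℝ) + r n)) ∧
      (∀ n : ℕ, EditSyndrome.CorrectsEdits k (Φ n)) ∧
      (∃ (P : EditSyndrome.Program) (T : Polynomial ℕ),
        ∀ (n : ℕ) (x : List.Vector (Fin (q n)) n),
          EditSyndrome.RunsWithin P
            (EditSyndrome.syndromeInput n (q n) x.toList)
            (EditSyndrome.Data.ofNat (Φ n x)) (T.eval n)) ∧
      (∃ (R : EditSyndrome.Program) (T : Polynomial ℕ),
        ∀ (n : ℕ) (x : List.Vector (Fin (q n)) n) (y : List (Fin (q n))),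
          EditSyndrome.WithinEdits k x.toList y →
            EditSyndrome.RunsWithin R
              (EditSyndrome.recoveryInput n (q n) y (Φ n x))
              (EditSyndrome.Data.ofString x.toList) (T.eval n)) := by
  obtain ⟨Q, hQ⟩ := EditSyndrome.exists_polynomial_bound hq_poly
  by_cases hk : k = 0
  · subst hk
    -- Without edits a constant syndrome suffices, and the recovery program returns `y`.
    refine ⟨fun _ => 1, fun _ _ => 0, ⟨fun _ => 0, EditSyndrome.const_isBigO_logb_logb 0,
      fun n _ => by simp⟩, fun n x x' y h h' hne => ?_,
      EditSyndrome.exists_syndrome_program hQ (.const 0), ?_⟩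
    · exact absurd (List.Vector.toList_injective (h.eq_of_zero.trans h'.eq_of_zero.symm)) hne
    · obtain ⟨R, T, hR⟩ := EditSyndrome.exists_recovery_program 0 (S := 0) hQ
        (EditSyndrome.PolyTime.fst.comp (EditSyndrome.PolyTime.snd.comp .snd))
      refine ⟨R, T, fun n x y hxy => ?_⟩
      rw [hxy.eq_of_zero, EditSyndrome.ofString_eq_enc]
      exact hR n y 0 (hxy.length_le.trans_eq (by rw [x.toList_length])) (Nat.zero_le _)
  · obtain ⟨S, hS⟩ := EditSyndrome.exists_syndromePrime_sq_bound k hq_pos hQ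
    refine ⟨fun n => EditSyndrome.syndromePrime k n (q n) ^ 2, fun n x =>
      ⟨EditSyndrome.syndrome k n (q n) (x.toList.map Fin.val),
        EditSyndrome.syndrome_lt hk (hq_pos n) x.toList_length⟩,
      ⟨_, EditSyndrome.const_isBigO_logb_logb _,
        fun n hn => EditSyndrome.syndromePrime_sq_le k hn (hq_pos n)⟩, ?_, ?_, ?_⟩
    · intro n x x' y h h' hne he
      exact hne (List.Vector.toList_injective (EditSyndrome.eq_of_syndrome_eq hk (hq_pos n)
        x.toList_length x'.toList_length h h' (congrArg Fin.val he)))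
    · exact EditSyndrome.exists_syndrome_program hQ
        (.syndrome k .fst (EditSyndrome.PolyTime.fst.comp .snd)
          (EditSyndrome.PolyTime.snd.comp .snd))
    · obtain ⟨R, T, hR⟩ := EditSyndrome.exists_recovery_program k (S := S) hQ
        (.recover k .fst (EditSyndrome.PolyTime.fst.comp .snd)
          (EditSyndrome.PolyTime.fst.comp (EditSyndrome.PolyTime.snd.comp .snd))
          (EditSyndrome.PolyTime.snd.comp (EditSyndrome.PolyTime.snd.comp .snd)))
      refine ⟨R, T, fun n x y hxy => ?_⟩
      have h := hR n y (EditSyndrome.syndrome k n (q n) (x.toList.map Fin.val))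
        (hxy.length_le.trans_eq (by rw [x.toList_length]))
        ((EditSyndrome.syndrome_lt hk (hq_pos n) x.toList_length).le.trans (hS n))
      rwa [EditSyndrome.recover_eq hk (hq_pos n) x.toList_length hxy,
        ← EditSyndrome.ofString_eq_enc] at h
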